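/- **Setting.** Let $(z_1,\dots,z_n)$ be linearly independent vectors in $\mathbb R^n$, let $\lambda\in[0,1]$, and let $f,g:\mathbb R^n\to\mathbb R$ be nonnegative, (Lebesgue) integrable functions with strictly positive integrals. *Inverse distribution functions.* For a nonnegative integrable $h:\mathbb R\to\mathbb R$ with $\int_{\mathbb R} h>0$, its inverse distribution function is $$u(t)=\inf\Big\{s\in\mathbb R:\ \int_{-\infty}^s h(x)\,dx>t\int_{\mathbb R}h(x)\,dx\Big\},\qquad t\in(0,1).$$ If $u,v$ are inverse distribution functions, a geometric primitive of $(u,v)$ in proportion $\lambda$ is any function $w(t)=\int_{1/2}^t u'(s)^{1-\lambda}v'(s)^{\lambda}\,ds+c$ on $(0,1)$, where $c\in\mathbb R$ and $u',v'$ are the a.e. defined pointwise derivatives. *Inverse distribution fields.* The $(z_1,\dots,z_n)$-inverse distribution field of $f$ is the vector field $U(t)=\sum_{i=1}^n u_i(t_1,\dots,t_i)\,z_i$, defined for a.e. $t\in(0,1)^n$, where, successively for $i=1,\dots,n$ and for a.e. $(t_1,\dots,t_{i-1})\in(0,1)^{i-1}$, the function $t_i\mapsto u_i(t_1,\dots,t_i)$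 is the inverse distribution function of $$x_i\mapsto\int_{\mathbb R^{n-i}}f\Big(\sum_{j<i}u_j(t_1,\dots,t_j)\,z_j+x_iz_i+\sum_{j>i}x_jz_j\Big)\,dx_{i+1}\cdots dx_n$$ (for $i=n$ there is no integration). Let $V(t)=\sum_i v_i(t_1,\dots,t_i)\,z_i$ be the corresponding field of $g$. *Geometric potentials.* A geometric potential of $(U,V)$ in proportion $\lambda$ is any Lebesgue measurable vector field $W_\lambda(t)=\sum_{i=1}^n w_{\lambda,i}(t_1,\dots,t_i)\,z_i$ on $(0,1)^n$ such that, for each $i$ and for a.e. $(t_1,\dots,t_{i-1})\in(0,1)^{i-1}$, the function $t_i\mapsto w_{\lambda,i}(t_1,\dots,t_i)$ is a geometric primitive in proportion $\lambda$ of $t_i\mapsto u_i(t_1,\dots,t_i)$ and $t_i\mapsto v_i(t_1,\dots,t_i)$. *Geometric combinations.* Let $D\subset(0,1)^n$ be the set of full measure of those $t$ for which, for every $i$, the functions of $x_i$ above, for $f$ and for $g$, are integrable with positive integral and $w_{\lambda,i}(t_1,\dots,t_{i-1},\cdot)$ is a geometric primitive as required; $W_\lambda$ is injective on $D$. The $(z_1,\dots,z_n)$-geometric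 combination of $(f,g)$ in proportion $\lambda$ associated with $W_\lambda$ is $$f\star_\lambda g\,(x)=\begin{cases}f(U(t))^{1-\lambda}\,g(V(t))^{\lambda}&\text{if }x=W_\lambda(t),\ t\in D,\\ 0&\text{otherwise.}\end{cases}$$ **Theorem.** For every geometric potential $W_\lambda$ of $(U,V)$ in proportion $\lambda$, the associated geometric combination $f\star_\lambda g$ is Lebesgue measurable and integrable on $\mathbb R^n$, and $$\int_{\mathbb R^n}f\star_\lambda g\,(x)\,dx=\Big(\int_{\mathbb R^n}f(x)\,dx\Big)^{1-\lambda}\Big(\int_{\mathbb R^n}g(x)\,dx\Big)^{\lambda}.$$ -/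

import Mathlib

open MeasureTheory Set

namespace GeomComb

noncomputable section

/-- `h` is integrable with strictly positive integral on the line
(the condition under which a nonnegative `h` has an inverse distribution function). -/
def Admissible (h : ℝ → ℝ) : Prop :=
  Integrable h volume ∧ 0 < ∫ x, h x

/-- Inverse distribution function of a function `h` of one real variable:
`u t = inf {s | ∫_{-∞}^s h > t ∫ h}`, meaningful for `t ∈ (0,1)`. -/
def idf (h : ℝ → ℝ) (t : ℝ) : ℝ :=
  sInf {s : ℝ | t * (∫ x, h x) < ∫ x in Iic s, h x}

/-- `w` is a geometric primitive of `(u, v)` in proportion `lam` on `(0,1)`: a primitive of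
`(u')^(1-lam) (v')^lam`, where `u'`, `v'` are the pointwise derivatives, which exist almost
everywhere on `(0,1)` since `u`, `v` are monotone there. -/
def IsGeomPrimitive (lam : ℝ) (u v w : ℝ → ℝ) : Prop :=
  ∃ c : ℝ, ∀ t ∈ Ioo (0 : ℝ) 1,
    w t = (∫ s in (1 / 2 : ℝ)..t, deriv u s ^ (1 - lam) * deriv v s ^ lam) + c

variable {n : ℕ}

/-- The open unit cube `(0,1)^n`. -/
def cube (n : ℕ) : Set (Fin n → ℝ) := {t | ∀ i, t i ∈ Ioo (0 : ℝ) 1}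

/-- The point `c 0 • z 0 + ⋯ + c (n-1) • z (n-1)`. -/
def combo (z : Fin n → Fin n → ℝ) (c : Fin n → ℝ) : Fin n → ℝ := ∑ i, c i • z i

/-- With the coordinates `c j`, `j < i`, frozen and the coordinates `y j`, `j > i`, integrated out,
the function of the remaining `i`-th coordinate
`s ↦ ∫ f (∑_{j < i} c j • z j + s • z i + ∑_{j > i} y j • z j) dy`.
The values `c j` with `j ≥ i` play no role. -/
def sliceMarginal (z : Fin n → Fin n → ℝ) (f : (Fin n → ℝ) → ℝ) (i : Fin n) (c : Fin n → ℝ)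
    (s : ℝ) : ℝ :=
  ∫ y : ↥(Finset.Ioi i) → ℝ,
    f (combo z (Function.updateFinset (Function.update c i s) (Finset.Ioi i) y))

/-- The components `u_i (t_0, …, t_i)` of the inverse distribution field of `f` along `z`:
`t_i ↦ u_i (t_0, …, t_i)` is the inverse distribution function of the `i`-th slice marginal of `f`
with frozen coordinates `u_j (t_0, …, t_j)`, `j < i`. -/
def idCoord (z : Fin n → Fin n → ℝ) (f : (Fin n → ℝ) → ℝ) (t : Fin n → ℝ) (i : Fin n) : ℝ :=
  idf (sliceMarginal z f i (fun j => if _h : j < i then idCoord z f t j else 0)) (t i)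
termination_by i

/-- The inverse distribution field `U t = ∑ i, u_i (t_0, …, t_i) • z i` of `f` along `z`. -/
def idField (z : Fin n → Fin n → ℝ) (f : (Fin n → ℝ) → ℝ) (t : Fin n → ℝ) : Fin n → ℝ :=
  combo z (idCoord z f t)

/-- At the point `t`, the map `t_i ↦ w_i (t_0, …, t_i)` (with `t_0, …, t_{i-1}` fixed) is a
geometric primitive of `t_i ↦ u_i (t_0, …, t_i)` and `t_i ↦ v_i (t_0, …, t_i)`, the components of
the inverse distribution fields of `f` and `g`. -/
def IsPrimitiveAt (z : Fin n → Fin n → ℝ) (f g : (Fin n → ℝ) → ℝ) (lam : ℝ)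
    (w : Fin n → (Fin n → ℝ) → ℝ) (i : Fin n) (t : Fin n → ℝ) : Prop :=
  IsGeomPrimitive lam
    (fun s => idCoord z f (Function.update t i s) i)
    (fun s => idCoord z g (Function.update t i s) i)
    (fun s => w i (Function.update t i s))

/-- `W t = ∑ i, w i t • z i` is a geometric potential in proportion `lam` of the inverse
distribution fields of `f` and `g` along `z`. -/
structure IsGeomPotential (z : Fin n → Fin n → ℝ) (f g : (Fin n → ℝ) → ℝ) (lam : ℝ)
    (w : Fin n → (Fin n → ℝ) → ℝ) : Prop where
  /-- `w i` is a function of `t_0, …, t_i` only. -/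
  triangular : ∀ i, ∀ t ∈ cube n, ∀ t' ∈ cube n, (∀ j ≤ i, t j = t' j) → w i t = w i t'
  /-- The vector field is Lebesgue measurable on the cube. -/
  measurable : ∀ i, AEMeasurable (w i) (volume.restrict (cube n))
  /-- For almost every `(t_0, …, t_{i-1})`, `t_i ↦ w_i` is a geometric primitive. As the property
  depends on `t_0, …, t_{i-1}` only, it is stated for almost every `t` in the cube. -/
  primitive : ∀ i, ∀ᵐ t ∂(volume.restrict (cube n)), IsPrimitiveAt z f g lam w i t

/-- The points of the cube at which all the steps of the construction of the two inverse
distribution fields and of the potential make sense (almost every point of the cube). -/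
def domain (z : Fin n → Fin n → ℝ) (f g : (Fin n → ℝ) → ℝ) (lam : ℝ)
    (w : Fin n → (Fin n → ℝ) → ℝ) : Set (Fin n → ℝ) :=
  {t ∈ cube n | ∀ i,
    Admissible (sliceMarginal z f i (idCoord z f t)) ∧
    Admissible (sliceMarginal z g i (idCoord z g t)) ∧
    IsPrimitiveAt z f g lam w i t}

open Classical in
/-- The geometric combination of `f` and `g` in proportion `lam` along `z` associated with the
potential `W t = ∑ i, w i t • z i`: its value at `x = W t` is `f (U t)^(1-lam) * g (V t)^lam`, and
it vanishes outside the range of `W`. (`W` is injective on `domain`, so `t` is unique.) -/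
def geomComb (z : Fin n → Fin n → ℝ) (f g : (Fin n → ℝ) → ℝ) (lam : ℝ)
    (w : Fin n → (Fin n → ℝ) → ℝ) (x : Fin n → ℝ) : ℝ :=
  if h : ∃ t ∈ domain z f g lam w, combo z (fun i => w i t) = x then
    f (idField z f h.choose) ^ (1 - lam) * g (idField z g h.choose) ^ lam
  else 0

end

end GeomComb

namespace GeomComb

open Filter Topology ENNReal

/-! ### Inverse distribution functions on the line -/

/-! Formally this is a change of variables along a triangular map. In the coordinates `c` of x =
`combo z c`, put F = f ∘ `combo z`, G = g ∘ `combo z`. The field U is a Knothe map: it carries the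
uniform law on the cube to the density F/∫F, so its Jacobian, the product of the ∂u_i/∂t_i, is ∫F /
F(U); likewise for V and G. Each ∂w_i/∂t_i is the geometric mean of ∂u_i/∂t_i and ∂v_i/∂t_i, so W
has Jacobian (∫F/F(U))^(1-λ) (∫G/G(V))^λ. Multiplied by the value F(U)^(1-λ) G(V)^λ of the
combination, it leaves a constant, integrated over a cube of volume 1. Returning to x multiplies all
integrals by one factor, and both sides are homogeneous of degree 1 in it.

No joint differentiability of these maps is available (U may even jump), so Jacobians are replaced
by push-forward measures and variables are added one at a time. On the line, `map_idf` gives the law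
of an inverse distribution function and `ae_deriv_idf` its derivative ∫h / h(u); a geometric
primitive is continuous and strictly increasing, and `rank` inverts it. `map_fieldPrefix` obtains
the law of the first k components of U by induction, with `map_idfStep` (Fubini) as the step.
`isChart_potPrefix` treats W in the same way through `IsChart.prod_shear`: each new factor of the
Jacobian involves ratios of consecutive marginals, and the product telescopes.
`integral_geomComb_combo` makes the final cancellation. -/

theorem continuous_setIntegral_Iic {h : ℝ → ℝ} (hi : Integrable h) :
    Continuous fun a => ∫ x in Iic a, h x := by
  have : (fun a => ∫ x in Iic a, h x) = fun a => (∫ x in (0 : ℝ)..a, h x) + ∫ x in Iic 0, h x := by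
    ext a
    rw [← intervalIntegral.integral_Iic_sub_Iic hi.integrableOn hi.integrableOn]
    ring
  rw [this]
  exact (hi.continuous_primitive 0).add continuous_const

theorem monotone_setIntegral_Iic {h : ℝ → ℝ} (hi : Integrable h) (h0 : ∀ x, 0 ≤ h x) :
    Monotone fun a => ∫ x in Iic a, h x := fun _ _ hab =>
  setIntegral_mono_set hi.integrableOn (Eventually.of_forall h0)
    (Iic_subset_Iic.2 hab).eventuallyLE

theorem ae_hasDerivAt_setIntegral_Iic {h : ℝ → ℝ} (hi : Integrable h) :
    ∀ᵐ x, HasDerivAt (fun a => ∫ x in Iic a, h x) (h x) x := by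
  filter_upwards [LocallyIntegrable.ae_hasDerivAt_integral hi.locallyIntegrable] with x hx
  have : (fun a => ∫ x in Iic a, h x) = fun a => (∫ x in (0 : ℝ)..a, h x) + ∫ x in Iic 0, h x := by
    ext a
    rw [← intervalIntegral.integral_Iic_sub_Iic hi.integrableOn hi.integrableOn]
    ring
  rw [this]
  exact (hx 0).add_const _

theorem tendsto_setIntegral_Iic_atTop {h : ℝ → ℝ} (hi : Integrable h) :
    Tendsto (fun a => ∫ x in Iic a, h x) atTop (𝓝 (∫ x, h x)) :=
  (aecover_Iic tendsto_id).integral_tendsto_of_countably_generated hi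

theorem tendsto_setIntegral_Iic_atBot {h : ℝ → ℝ} :
    Tendsto (fun a => ∫ x in Iic a, h x) atBot (𝓝 0) :=
  tendsto_integral_Iic_zero tendsto_id

/-- By continuity of the distribution function the set defining `idf` is open, so its infimum is not
attained. All later facts about `idf` rest on this equivalence. -/
theorem idf_lt_iff {h : ℝ → ℝ} (ha : Admissible h) (h0 : ∀ x, 0 ≤ h x) {t : ℝ}
    (ht : t ∈ Ioo (0 : ℝ) 1) (a : ℝ) : idf h t < a ↔ t * (∫ x, h x) < ∫ x in Iic a, h x := by
  obtain ⟨hi, hp⟩ := ha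
  have hmono := monotone_setIntegral_Iic hi h0
  have hne : {s : ℝ | t * (∫ x, h x) < ∫ x in Iic s, h x}.Nonempty :=
    ((tendsto_setIntegral_Iic_atTop hi).eventually_const_lt
      (show t * (∫ x, h x) < ∫ x, h x by nlinarith [ht.2])).exists
  have hbdd : BddBelow {s : ℝ | t * (∫ x, h x) < ∫ x in Iic s, h x} := by
    obtain ⟨b, hb⟩ := ((tendsto_setIntegral_Iic_atBot (h := h)).eventually_lt_const
      (show 0 < t * (∫ x, h x) from mul_pos ht.1 hp)).exists
    refine ⟨b, fun s hs => ?_⟩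
    by_contra! hlt
    exact absurd (hmono hlt.le) (not_le.2 (hb.trans hs))
  rw [idf, csInf_lt_iff hbdd hne]
  constructor
  · rintro ⟨b, hb, hba⟩
    exact lt_of_lt_of_le hb (hmono hba.le)
  · intro hlt
    have hev : ∀ᶠ b in 𝓝[<] a, t * (∫ x, h x) < ∫ x in Iic b, h x :=
      ((continuous_setIntegral_Iic hi).tendsto a).eventually_const_lt hlt |>.filter_mono
        nhdsWithin_le_nhds
    obtain ⟨b, hb, hb'⟩ := (hev.and self_mem_nhdsWithin).exists
    exact ⟨b, hb, hb'⟩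

theorem setIntegral_Iic_idf {h : ℝ → ℝ} (ha : Admissible h) (h0 : ∀ x, 0 ≤ h x) {t : ℝ}
    (ht : t ∈ Ioo (0 : ℝ) 1) : ∫ x in Iic (idf h t), h x = t * ∫ x, h x := by
  apply le_antisymm
  · exact not_lt.1 fun hlt => lt_irrefl _ ((idf_lt_iff ha h0 ht _).2 hlt)
  · refine ge_of_tendsto (x := 𝓝[>] (idf h t))
      (((continuous_setIntegral_Iic ha.1).tendsto (idf h t)).mono_left nhdsWithin_le_nhds) ?_
    filter_upwards [self_mem_nhdsWithin] with b hb
    exact ((idf_lt_iff ha h0 ht b).1 hb).le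

theorem strictMonoOn_idf {h : ℝ → ℝ} (ha : Admissible h) (h0 : ∀ x, 0 ≤ h x) :
    StrictMonoOn (idf h) (Ioo 0 1) := by
  intro s hs t ht hst
  rw [idf_lt_iff ha h0 hs, setIntegral_Iic_idf ha h0 ht]
  exact mul_lt_mul_of_pos_right hst ha.2

theorem aemeasurable_idf {h : ℝ → ℝ} (ha : Admissible h) (h0 : ∀ x, 0 ≤ h x) :
    AEMeasurable (idf h) (volume.restrict (Ioo 0 1)) :=
  aemeasurable_restrict_of_monotoneOn measurableSet_Ioo (strictMonoOn_idf ha h0).monotoneOn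

/-- Inverse transform sampling: by `idf_lt_iff` the preimage of a half-line is, up to the endpoint
0, an interval starting at the normalised distribution function, and half-lines determine a finite
measure. -/
theorem map_idf {h : ℝ → ℝ} (ha : Admissible h) (h0 : ∀ x, 0 ≤ h x) :
    (volume.restrict (Ioo (0 : ℝ) 1)).map (idf h)
      = volume.withDensity fun x => ENNReal.ofReal (h x / ∫ x, h x) := by
  have : IsFiniteMeasure ((volume.restrict (Ioo (0 : ℝ) 1)).map (idf h)) := by
    infer_instance
  refine Measure.ext_of_Ici _ _ fun a => ?_
  rw [Measure.map_apply_of_aemeasurable (aemeasurable_idf ha h0) measurableSet_Ici,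
    withDensity_apply _ measurableSet_Ici,
    Measure.restrict_apply' measurableSet_Ioo,
    ← ofReal_integral_eq_lintegral_ofReal (ha.1.div_const _).integrableOn
      (Eventually.of_forall fun x => div_nonneg (h0 x) ha.2.le), integral_div]
  have hsplit : (∫ x in Iic a, h x) + ∫ x in Ici a, h x = ∫ x, h x := by
    rw [integral_Ici_eq_integral_Ioi, ← compl_Iic]
    exact integral_add_compl measurableSet_Iic ha.1
  have h1 : 0 ≤ ∫ x in Iic a, h x := integral_nonneg h0
  have h2 : 0 ≤ ∫ x in Ici a, h x := integral_nonneg h0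
  have hset : idf h ⁻¹' Ici a ∩ Ioo 0 1 = Ico ((∫ x in Iic a, h x) / ∫ x, h x) 1 ∩ Ioo 0 1 := by
    ext t
    simp only [mem_inter_iff, mem_preimage, mem_Ici, mem_Ico, and_congr_left_iff]
    intro ht
    rw [← not_lt, idf_lt_iff ha h0 ht, not_lt, div_le_iff₀ ha.2]
    exact ⟨fun h => ⟨h, ht.2⟩, fun h => h.1⟩
  have hae : (Ico ((∫ x in Iic a, h x) / ∫ x, h x) 1 ∩ Ioo 0 1 : Set ℝ)
      =ᵐ[volume] Ico ((∫ x in Iic a, h x) / ∫ x, h x) 1 := by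
    have hne : ∀ᵐ x : ℝ, x ≠ 0 := by simp [ae_iff]
    filter_upwards [hne] with x hx
    refine propext ⟨fun h => h.1, fun h => ⟨h, lt_of_le_of_ne ?_ hx.symm, h.2⟩⟩
    exact (div_nonneg h1 ha.2.le).trans h.1
  rw [hset, measure_congr hae, Real.volume_Ico]
  congr 1
  rw [← hsplit]
  have := ha.2
  rw [← hsplit] at this
  field_simp
  ring

/-- `idf h` is a right inverse of the normalised distribution function. Lebesgue differentiation
holds at almost every point for the measure with density `h`, hence at `idf h t` for almost every
`t` by `map_idf`. Being monotone, `idf h` has countably many discontinuities; elsewhere the inverse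
function rule applies. -/
theorem ae_hasDerivAt_idf {h : ℝ → ℝ} (ha : Admissible h) (h0 : ∀ x, 0 ≤ h x) :
    ∀ᵐ t ∂(volume.restrict (Ioo (0 : ℝ) 1)),
      0 < h (idf h t) ∧ HasDerivAt (idf h) ((∫ x, h x) / h (idf h t)) t := by
  have h1 : ∀ᵐ t ∂(volume.restrict (Ioo (0 : ℝ) 1)),
      0 < h (idf h t) ∧ HasDerivAt (fun a => ∫ x in Iic a, h x) (h (idf h t)) (idf h t) := by
    refine ae_of_ae_map (aemeasurable_idf ha h0)
      (p := fun y => 0 < h y ∧ HasDerivAt (fun a => ∫ x in Iic a, h x) (h y) y) ?_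
    rw [map_idf ha h0, ae_withDensity_iff' (by have := ha.1.aemeasurable; fun_prop)]
    filter_upwards [ae_hasDerivAt_setIntegral_Iic ha.1] with y hy hne
    -- The law of `idf h` does not charge the zeros of `h`.
    refine ⟨lt_of_le_of_ne (h0 y) fun h => hne ?_, hy⟩
    rw [← h]
    simp
  have h2 : ∀ᵐ t ∂(volume.restrict (Ioo (0 : ℝ) 1)), ContinuousAt (idf h) t := by
    have hc := (strictMonoOn_idf ha h0).monotoneOn.countable_not_continuousWithinAt
    rw [ae_restrict_iff' measurableSet_Ioo]
    filter_upwards [hc.ae_notMem volume] with t ht htI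
    by_contra hcon
    exact ht ⟨htI, fun hw => hcon (hw.continuousAt (Ioo_mem_nhds htI.1 htI.2))⟩
  filter_upwards [h1, h2, ae_restrict_mem measurableSet_Ioo] with t ⟨hpos, hd⟩ hc ht
  refine ⟨hpos, ?_⟩
  have := HasDerivAt.of_local_left_inverse (f := fun y => (∫ x in Iic y, h x) / ∫ x, h x) hc
    (hd.div_const _) (div_pos hpos ha.2).ne' ?_
  · rwa [inv_div] at this
  · filter_upwards [Ioo_mem_nhds ht.1 ht.2] with s hs
    rw [setIntegral_Iic_idf ha h0 hs, mul_div_cancel_right₀ _ ha.2.ne']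

theorem ae_deriv_idf {h : ℝ → ℝ} (ha : Admissible h) (h0 : ∀ x, 0 ≤ h x) :
    ∀ᵐ t ∂(volume.restrict (Ioo (0 : ℝ) 1)),
      deriv (idf h) t = (∫ x, h x) / h (idf h t) ∧ 0 < deriv (idf h) t := by
  filter_upwards [ae_hasDerivAt_idf ha h0] with t ht
  rw [ht.2.deriv]
  exact ⟨rfl, div_pos ha.2 ht.1⟩

theorem uIcc_subset_Ioo {a b c d : ℝ} (ha : a ∈ Ioo c d) (hb : b ∈ Ioo c d) :
    uIcc a b ⊆ Ioo c d :=
  ordConnected_Ioo.uIcc_subset ha hb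

theorem intervalIntegrable_deriv_rpow_mul {lam : ℝ} (hlam : lam ∈ Icc (0 : ℝ) 1) {h k : ℝ → ℝ}
    (hh : Admissible h) (hk : Admissible k) (h0 : ∀ x, 0 ≤ h x) (k0 : ∀ x, 0 ≤ k x)
    {a b : ℝ} (ha : a ∈ Ioo (0 : ℝ) 1) (hb : b ∈ Ioo (0 : ℝ) 1) :
    IntervalIntegrable (fun s => deriv (idf h) s ^ (1 - lam) * deriv (idf k) s ^ lam)
      volume a b := by
  have hsub := uIcc_subset_Ioo ha hb
  -- The weighted arithmetic mean dominates the geometric one, and derivatives of monotone functions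
  -- are integrable on compact subintervals of (0,1).
  have hI : IntervalIntegrable
      (fun s => (1 - lam) * deriv (idf h) s + lam * deriv (idf k) s) volume a b :=
    (((strictMonoOn_idf hh h0).monotoneOn.mono hsub).intervalIntegrable_deriv.const_mul _).add
      (((strictMonoOn_idf hk k0).monotoneOn.mono hsub).intervalIntegrable_deriv.const_mul _)
  refine hI.mono_fun ?_ ?_
  · have h1 := measurable_deriv (idf h)
    have h2 := measurable_deriv (idf k)
    exact ((h1.pow_const _).mul (h2.pow_const _)).aestronglyMeasurable
  · have hle : volume.restrict (uIoc a b) ≤ volume.restrict (Ioo (0 : ℝ) 1) :=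
      Measure.restrict_mono (uIoc_subset_uIcc.trans hsub) le_rfl
    refine ae_mono hle ?_
    filter_upwards [ae_deriv_idf hh h0, ae_deriv_idf hk k0] with s ⟨_, h1⟩ ⟨_, h2⟩
    rw [Real.norm_of_nonneg (by positivity)]
    refine le_trans ?_ (le_abs_self _)
    exact Real.geom_mean_le_arith_mean2_weighted (by linarith [hlam.2]) hlam.1 h1.le h2.le (by ring)

theorem IsGeomPrimitive.sub_eq {lam : ℝ} (hlam : lam ∈ Icc (0 : ℝ) 1) {h k w : ℝ → ℝ}
    (hh : Admissible h) (hk : Admissible k) (h0 : ∀ x, 0 ≤ h x) (k0 : ∀ x, 0 ≤ k x)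
    (hw : IsGeomPrimitive lam (idf h) (idf k) w) {a b : ℝ} (ha : a ∈ Ioo (0 : ℝ) 1)
    (hb : b ∈ Ioo (0 : ℝ) 1) :
    w b - w a = ∫ s in a..b, deriv (idf h) s ^ (1 - lam) * deriv (idf k) s ^ lam := by
  obtain ⟨c, hc⟩ := hw
  have hm : (1 / 2 : ℝ) ∈ Ioo (0 : ℝ) 1 := by norm_num
  rw [hc a ha, hc b hb, ← intervalIntegral.integral_interval_sub_left
    (intervalIntegrable_deriv_rpow_mul hlam hh hk h0 k0 hm hb)
    (intervalIntegrable_deriv_rpow_mul hlam hh hk h0 k0 hm ha)]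
  ring

theorem IsGeomPrimitive.continuousOn {lam : ℝ} (hlam : lam ∈ Icc (0 : ℝ) 1) {h k w : ℝ → ℝ}
    (hh : Admissible h) (hk : Admissible k) (h0 : ∀ x, 0 ≤ h x) (k0 : ∀ x, 0 ≤ k x)
    (hw : IsGeomPrimitive lam (idf h) (idf k) w) : ContinuousOn w (Ioo 0 1) := by
  intro t ht
  refine ContinuousAt.continuousWithinAt ?_
  obtain ⟨a, ha0, hat⟩ := exists_between ht.1
  obtain ⟨b, htb, hb1⟩ := exists_between ht.2
  have ha : a ∈ Ioo (0 : ℝ) 1 := ⟨ha0, hat.trans ht.2⟩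
  have hb : b ∈ Ioo (0 : ℝ) 1 := ⟨ht.1.trans htb, hb1⟩
  have hab := hat.trans htb
  have hcont := intervalIntegral.continuousOn_primitive_interval
    ((intervalIntegrable_iff_integrableOn_Icc_of_le hab.le).1
      (intervalIntegrable_deriv_rpow_mul hlam hh hk h0 k0 ha hb) |>.mono_set (uIcc_of_le hab.le).le)
  rw [uIcc_of_le hab.le] at hcont
  have := (hcont.continuousAt (Icc_mem_nhds hat htb)).add_const (w a)
  refine this.congr ?_
  filter_upwards [Ioo_mem_nhds ht.1 ht.2] with s hs
  rw [← hw.sub_eq hlam hh hk h0 k0 ha hs]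
  ring

/-- The density of the geometric primitive of two inverse distribution functions. -/
theorem IsGeomPrimitive.lintegral_Ioo {lam : ℝ} (hlam : lam ∈ Icc (0 : ℝ) 1) {h k w : ℝ → ℝ}
    (hh : Admissible h) (hk : Admissible k) (h0 : ∀ x, 0 ≤ h x) (k0 : ∀ x, 0 ≤ k x)
    (hw : IsGeomPrimitive lam (idf h) (idf k) w) {a b : ℝ} (ha : a ∈ Ioo (0 : ℝ) 1)
    (hb : b ∈ Ioo (0 : ℝ) 1) (hab : a < b) :
    w a < w b ∧ ∫⁻ s in Ioo a b, ENNReal.ofReal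
      (((∫ x, h x) / h (idf h s)) ^ (1 - lam) * ((∫ x, k x) / k (idf k s)) ^ lam)
        = ENNReal.ofReal (w b - w a) := by
  have hint := intervalIntegrable_deriv_rpow_mul hlam hh hk h0 k0 ha hb
  rw [intervalIntegrable_iff_integrableOn_Ioo_of_le hab.le] at hint
  have hle : volume.restrict (Ioo a b) ≤ volume.restrict (Ioo (0 : ℝ) 1) :=
    Measure.restrict_mono (Ioo_subset_Ioo ha.1.le hb.2.le) le_rfl
  have hd : ∀ᵐ s ∂(volume.restrict (Ioo a b)),
      0 < deriv (idf h) s ^ (1 - lam) * deriv (idf k) s ^ lam ∧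
      ((∫ x, h x) / h (idf h s)) ^ (1 - lam) * ((∫ x, k x) / k (idf k s)) ^ lam
        = deriv (idf h) s ^ (1 - lam) * deriv (idf k) s ^ lam := by
    refine ae_mono hle ?_
    filter_upwards [ae_deriv_idf hh h0, ae_deriv_idf hk k0] with s ⟨e1, h1⟩ ⟨e2, h2⟩
    rw [← e1, ← e2]
    exact ⟨by positivity, rfl⟩
  have heq : w b - w a = ∫ s in Ioo a b, deriv (idf h) s ^ (1 - lam) * deriv (idf k) s ^ lam := by
    rw [hw.sub_eq hlam hh hk h0 k0 ha hb, intervalIntegral.integral_of_le hab.le,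
      integral_Ioc_eq_integral_Ioo]
  have hnn : 0 ≤ᵐ[volume.restrict (Ioo a b)]
      fun s => deriv (idf h) s ^ (1 - lam) * deriv (idf k) s ^ lam :=
    hd.mono fun s hs => hs.1.le
  constructor
  · rw [← sub_pos, heq]
    -- A zero increment would force an almost everywhere positive integrand to vanish almost
    -- everywhere on an interval of positive length.
    refine lt_of_le_of_ne (integral_nonneg_of_ae hnn) fun h => ?_
    have hz := (integral_eq_zero_iff_of_nonneg_ae hnn hint).1 h.symm
    have hfalse : ∀ᵐ _ ∂(volume.restrict (Ioo a b)), False := by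
      filter_upwards [hz, hd] with s h1 h2
      exact h2.1.ne' h1
    rw [ae_iff] at hfalse
    simp at hfalse
    linarith
  · rw [heq, ofReal_integral_eq_lintegral_ofReal hint hnn]
    exact lintegral_congr_ae (hd.mono fun s hs => by simp only [hs.2])

theorem IsGeomPrimitive.strictMonoOn {lam : ℝ} (hlam : lam ∈ Icc (0 : ℝ) 1) {h k w : ℝ → ℝ}
    (hh : Admissible h) (hk : Admissible k) (h0 : ∀ x, 0 ≤ h x) (k0 : ∀ x, 0 ≤ k x)
    (hw : IsGeomPrimitive lam (idf h) (idf k) w) : StrictMonoOn w (Ioo 0 1) :=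
  fun _ ha _ hb hab => (hw.lintegral_Ioo hlam hh hk h0 k0 ha hb hab).1

/-! ### Inverting monotone functions of the last variable -/

noncomputable section

/-- Lebesgue measure on the unit interval. -/
abbrev unitVol : Measure ℝ := volume.restrict (Ioo 0 1)

/-- The measure of `{s ∈ (0,1) | ψ s < r}`, which inverts a strictly increasing `ψ` on `(0,1)`. -/
def rank (ψ : ℝ → ℝ) (r : ℝ) : ℝ := unitVol.real {s | ψ s < r}

end

theorem rank_apply {ψ : ℝ → ℝ} (hψ : StrictMonoOn ψ (Ioo 0 1)) {s : ℝ} (hs : s ∈ Ioo (0 : ℝ) 1) :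
    rank ψ (ψ s) = s := by
  have : {a | ψ a < ψ s} ∩ Ioo (0 : ℝ) 1 = Ioo 0 s := by
    ext a
    simp only [mem_inter_iff, mem_ofPred_eq, mem_Ioo]
    constructor
    · rintro ⟨h1, h2⟩
      exact ⟨h2.1, (hψ.lt_iff_lt h2 hs).1 h1⟩
    · rintro ⟨h1, h2⟩
      have ha : a ∈ Ioo (0 : ℝ) 1 := ⟨h1, h2.trans hs.2⟩
      exact ⟨(hψ.lt_iff_lt ha hs).2 h2, ha⟩
  rw [rank, measureReal_def, Measure.restrict_apply' measurableSet_Ioo, this, Real.volume_Ioo,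
    ENNReal.toReal_ofReal (by linarith [hs.1])]
  ring

/-- Off the range of `ψ` the rank is 0 or 1, so belonging to the range becomes a measurable
condition on `r`. -/
theorem exists_eq_of_rank_mem {ψ : ℝ → ℝ} (hc : ContinuousOn ψ (Ioo 0 1)) {r : ℝ}
    (hr : rank ψ r ∈ Ioo (0 : ℝ) 1) : ∃ s ∈ Ioo (0 : ℝ) 1, ψ s = r := by
  have h1 : ∃ a ∈ Ioo (0 : ℝ) 1, ψ a < r := by
    by_contra! h
    have : {s | ψ s < r} ∩ Ioo (0 : ℝ) 1 = ∅ := by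
      ext a
      simp only [mem_inter_iff, mem_ofPred_eq, mem_empty_iff_false, iff_false, not_and]
      exact fun h1 h2 => absurd (h a h2) (not_le.2 h1)
    have h0 := hr.1
    rw [rank, measureReal_def, Measure.restrict_apply' measurableSet_Ioo, this] at h0
    simp at h0
  have h2 : ∃ b ∈ Ioo (0 : ℝ) 1, r ≤ ψ b := by
    by_contra! h
    have : {s | ψ s < r} ∩ Ioo (0 : ℝ) 1 = Ioo 0 1 := inter_eq_right.2 h
    have h0 := hr.2
    rw [rank, measureReal_def, Measure.restrict_apply' measurableSet_Ioo, this] at h0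
    simp at h0
  obtain ⟨a, ha, har⟩ := h1
  obtain ⟨b, hb, hbr⟩ := h2
  exact isPreconnected_Ioo.intermediate_value ha hb hc ⟨har.le, hbr⟩

theorem monotone_rank (ψ : ℝ → ℝ) : Monotone (rank ψ) := fun _ _ hab =>
  measureReal_mono fun _ hs => lt_of_lt_of_le hs hab

theorem rank_preimage_Ioo {ψ : ℝ → ℝ} (hψ : StrictMonoOn ψ (Ioo 0 1))
    (hc : ContinuousOn ψ (Ioo 0 1)) {a b : ℝ} (ha : a ∈ Ioo (0 : ℝ) 1) (hb : b ∈ Ioo (0 : ℝ) 1) :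
    rank ψ ⁻¹' Ioo a b = Ioo (ψ a) (ψ b) := by
  ext r
  constructor
  · intro hr
    obtain ⟨s, hs, rfl⟩ := exists_eq_of_rank_mem hc ⟨ha.1.trans hr.1, hr.2.trans hb.2⟩
    rw [mem_preimage, rank_apply hψ hs] at hr
    exact ⟨hψ ha hs hr.1, hψ hs hb hr.2⟩
  · intro hr
    obtain ⟨s, hs, rfl⟩ := isPreconnected_Ioo.intermediate_value ha hb hc ⟨hr.1.le, hr.2.le⟩
    rw [mem_preimage, rank_apply hψ hs]
    exact ⟨(hψ.lt_iff_lt ha hs).1 hr.1, (hψ.lt_iff_lt hs hb).1 hr.2⟩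

/-- Two measures on the line which agree on the compactly contained subintervals of `(0,1)`, where
they are finite, agree on `(0,1)`. -/
theorem restrict_unitInterval_ext {m₁ m₂ : Measure ℝ}
    (hfin : ∀ a ∈ Ioo (0 : ℝ) 1, ∀ b ∈ Ioo (0 : ℝ) 1, a < b → m₁ (Ioo a b) < ∞)
    (heq : ∀ a ∈ Ioo (0 : ℝ) 1, ∀ b ∈ Ioo (0 : ℝ) 1, a < b → m₁ (Ioo a b) = m₂ (Ioo a b)) :
    m₁.restrict (Ioo 0 1) = m₂.restrict (Ioo 0 1) := by
  have hU : Ioo (0 : ℝ) 1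
      = ⋃ p : {p : ℚ × ℚ // (p.1 : ℝ) ∈ Ioo (0 : ℝ) 1 ∧ (p.2 : ℝ) ∈ Ioo (0 : ℝ) 1 ∧ p.1 < p.2},
        Ioo (p.1.1 : ℝ) (p.1.2 : ℝ) := by
    ext s
    simp only [mem_iUnion, Subtype.exists, Prod.exists]
    constructor
    · intro hs
      obtain ⟨a, ha0, has⟩ := exists_rat_btwn hs.1
      obtain ⟨b, hsb, hb1⟩ := exists_rat_btwn hs.2
      exact ⟨a, b, ⟨⟨ha0, has.trans hs.2⟩, ⟨hs.1.trans hsb, hb1⟩,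
        by exact_mod_cast has.trans hsb⟩, has, hsb⟩
    · rintro ⟨a, b, ⟨ha, hb, _⟩, hs⟩
      exact ⟨ha.1.trans hs.1, hs.2.trans hb.2⟩
  rw [hU, Measure.restrict_iUnion_congr]
  rintro ⟨⟨a, b⟩, ha, hb, hab⟩
  have hab' : (a : ℝ) < b := by exact_mod_cast hab
  dsimp only
  have : IsFiniteMeasure (m₁.restrict (Ioo (a : ℝ) b)) :=
    ⟨by rw [Measure.restrict_apply_univ]; exact hfin _ ha _ hb hab'⟩
  refine Real.measure_ext_Ioo_rat fun c d => ?_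
  rw [Measure.restrict_apply measurableSet_Ioo, Measure.restrict_apply measurableSet_Ioo,
    Ioo_inter_Ioo]
  rcases lt_or_ge (max (c : ℝ) a) (min (d : ℝ) b) with h | h
  · refine heq _ ⟨lt_max_of_lt_right ha.1, h.trans_le ((min_le_right _ _).trans hb.2.le)⟩ _
      ⟨ha.1.trans_le ((le_max_right _ _).trans h.le), min_lt_of_right_lt hb.2⟩ h
  · simp [Ioo_eq_empty (not_lt.2 h)]

/-- On (0,1) `rank ψ` inverts `ψ`, so it pulls `Ioo a b` back to an interval of length `ψ b - ψ a`,
which `hk` identifies with the mass given by `k`. -/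
theorem map_rank {ψ : ℝ → ℝ} (hψ : StrictMonoOn ψ (Ioo 0 1)) (hc : ContinuousOn ψ (Ioo 0 1))
    {k : ℝ → ℝ≥0∞} (hk : ∀ a ∈ Ioo (0 : ℝ) 1, ∀ b ∈ Ioo (0 : ℝ) 1, a < b →
      ∫⁻ s in Ioo a b, k s = ENNReal.ofReal (ψ b - ψ a)) :
    (volume.map (rank ψ)).restrict (Ioo 0 1) = unitVol.withDensity k := by
  rw [← restrict_withDensity measurableSet_Ioo]
  have hval : ∀ a ∈ Ioo (0 : ℝ) 1, ∀ b ∈ Ioo (0 : ℝ) 1,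
      volume.map (rank ψ) (Ioo a b) = ENNReal.ofReal (ψ b - ψ a) := fun a ha b hb => by
    rw [Measure.map_apply (monotone_rank ψ).measurable measurableSet_Ioo,
      rank_preimage_Ioo hψ hc ha hb, Real.volume_Ioo]
  refine restrict_unitInterval_ext (fun a ha b hb _ => ?_) fun a ha b hb hab => ?_
  · rw [hval a ha b hb]
    exact ofReal_lt_top
  · rw [hval a ha b hb, withDensity_apply _ measurableSet_Ioo, hk a ha b hb hab]

/-- This is the reason for inverting through a measure: `rank` is the measure of a section of a
jointly measurable set, and changing `ψ x` on a null set does not affect it. -/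
theorem aemeasurable_rank {X : Type*} [MeasurableSpace X] {μ : Measure X} [SFinite μ]
    {ψ : X → ℝ → ℝ} (hψ : AEMeasurable (Function.uncurry ψ) (μ.prod unitVol)) (ν : Measure ℝ)
    [SFinite ν] : AEMeasurable (fun p : X × ℝ => rank (ψ p.1) p.2) (μ.prod ν) := by
  refine ⟨fun p => rank (fun s => hψ.mk _ (p.1, s)) p.2, ?_, ?_⟩
  · have hm : MeasurableSet {q : (X × ℝ) × ℝ | hψ.mk _ (q.1.1, q.2) < q.1.2} :=
      measurableSet_lt (hψ.measurable_mk.comp (by fun_prop)) (by fun_prop)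
    exact (measurable_measure_prodMk_left (ν := unitVol) hm).ennreal_toReal
  · have h := Measure.ae_ae_of_ae_prod hψ.ae_eq_mk
    filter_upwards [Measure.quasiMeasurePreserving_fst.ae h] with p hp
    rw [rank, rank, measureReal_def, measureReal_def]
    congr 1
    refine measure_congr ?_
    filter_upwards [hp] with s hs
    refine propext ?_
    change ψ p.1 s < p.2 ↔ hψ.mk _ (p.1, s) < p.2
    rw [← hs]
    rfl

theorem nullMeasurableSet_of_ae {X : Type*} [MeasurableSpace X] {μ : Measure X} {G : Set X}
    (h : ∀ᵐ x ∂μ, x ∈ G) : NullMeasurableSet G μ :=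
  nullMeasurableSet_univ.congr (h.mono fun _ hx => (eq_true hx).symm)

/-! ### Shears: changing the last variable along fibres -/

section Shear

variable {X : Type*} [MeasurableSpace X] {μ : Measure X} [SFinite μ] {G : Set X}
  {ψ : X → ℝ → ℝ} {k : X × ℝ → ℝ≥0∞}

theorem nullMeasurableSet_shear_range (hG : ∀ᵐ x ∂μ, x ∈ G)
    (hψ : AEMeasurable (Function.uncurry ψ) (μ.prod unitVol)) :
    NullMeasurableSet {p : X × ℝ | p.1 ∈ G ∧ rank (ψ p.1) p.2 ∈ Ioo (0 : ℝ) 1}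
      (μ.prod volume) :=
  (nullMeasurableSet_of_ae (Measure.quasiMeasurePreserving_fst.ae hG)).inter
    ((aemeasurable_rank hψ volume).nullMeasurableSet_preimage measurableSet_Ioo)

/-- By Fubini the claim is `map_rank` on almost every fibre. -/
theorem map_shear (hG : ∀ᵐ x ∂μ, x ∈ G)
    (hψ : AEMeasurable (Function.uncurry ψ) (μ.prod unitVol))
    (hmono : ∀ x ∈ G, StrictMonoOn (ψ x) (Ioo 0 1)) (hcont : ∀ x ∈ G, ContinuousOn (ψ x) (Ioo 0 1))
    (hk : AEMeasurable k (μ.prod unitVol))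
    (hint : ∀ᵐ x ∂μ, ∀ a ∈ Ioo (0 : ℝ) 1, ∀ b ∈ Ioo (0 : ℝ) 1, a < b →
      ∫⁻ s in Ioo a b, k (x, s) = ENNReal.ofReal (ψ x b - ψ x a)) :
    ((μ.prod volume).restrict {p : X × ℝ | p.1 ∈ G ∧ rank (ψ p.1) p.2 ∈ Ioo (0 : ℝ) 1}).map
      (fun p => (p.1, rank (ψ p.1) p.2)) = (μ.prod unitVol).withDensity k := by
  have hE := nullMeasurableSet_shear_range hG hψ
  have hΘ : AEMeasurable (fun p : X × ℝ => (p.1, rank (ψ p.1) p.2)) (μ.prod volume) :=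
    measurable_fst.aemeasurable.prodMk (aemeasurable_rank hψ volume)
  ext A hA
  have hN := (hΘ.nullMeasurableSet_preimage hA).inter hE
  have h1m : AEMeasurable (1 : X × ℝ → ℝ≥0∞) (μ.prod volume) := measurable_one.aemeasurable
  rw [Measure.map_apply_of_aemeasurable hΘ.restrict hA, Measure.restrict_apply₀' hE,
    withDensity_apply _ hA, ← lintegral_indicator_one₀ hN, lintegral_prod _ (h1m.indicator₀ hN),
    ← lintegral_indicator hA, lintegral_prod _ (hk.indicator hA)]
  refine lintegral_congr_ae ?_
  filter_upwards [hG, hint] with x hx hix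
  have hr := (monotone_rank (ψ x)).measurable
  have hAx : MeasurableSet (Prod.mk x ⁻¹' A) := measurable_prodMk_left hA
  have h1 : ∀ r, ((fun p : X × ℝ => (p.1, rank (ψ p.1) p.2)) ⁻¹' A ∩
      {p : X × ℝ | p.1 ∈ G ∧ rank (ψ p.1) p.2 ∈ Ioo (0 : ℝ) 1}).indicator (1 : X × ℝ → ℝ≥0∞) (x, r)
      = (rank (ψ x) ⁻¹' (Prod.mk x ⁻¹' A ∩ Ioo 0 1)).indicator 1 r := fun r => by
    classical
    rw [indicator_apply, indicator_apply]
    exact if_congr (by simp [hx]) rfl rfl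
  simp only [h1]
  rw [lintegral_indicator_one (hr (hAx.inter measurableSet_Ioo)),
    ← Measure.map_apply hr (hAx.inter measurableSet_Ioo), ← Measure.restrict_apply hAx,
    map_rank (hmono x hx) (hcont x hx) hix, withDensity_apply _ hAx, ← lintegral_indicator hAx]
  rfl

end Shear

/-! ### Injective maps with a change of variables formula -/

/-- `W` is injective on `D`, its range `W '' D` is `ν`-null measurable, and the inverse of `W`
transports `ν` on that range to the measure `μ` with density `J`. -/
def IsChart {X Y : Type*} [MeasurableSpace X] [MeasurableSpace Y] (μ : Measure X) (ν : Measure Y)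
    (D : Set X) (W : X → Y) (J : X → ℝ≥0∞) : Prop :=
  ∃ T : Y → X, (∀ x ∈ D, T (W x) = x) ∧ NullMeasurableSet (W '' D) ν ∧
    AEMeasurable T (ν.restrict (W '' D)) ∧
    (ν.restrict (W '' D)).map T = μ.withDensity J

theorem map_prodMap_id {X Y : Type*} [MeasurableSpace X] [MeasurableSpace Y]
    {ν : Measure Y} [SFinite ν] {T : Y → X} (hT : AEMeasurable T ν) (σ : Measure ℝ) [SFinite σ] :
    AEMeasurable (fun p : Y × ℝ => (T p.1, p.2)) (ν.prod σ) ∧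
    (ν.prod σ).map (fun p : Y × ℝ => (T p.1, p.2)) = (ν.map T).prod σ := by
  have h1 : (fun p : Y × ℝ => (T p.1, p.2)) =ᵐ[ν.prod σ] Prod.map (hT.mk T) id := by
    filter_upwards [Measure.quasiMeasurePreserving_fst.ae hT.ae_eq_mk] with p hp
    simp [Prod.map, hp]
  refine ⟨⟨_, hT.measurable_mk.prodMap measurable_id, h1⟩, ?_⟩
  rw [Measure.map_congr h1, ← Measure.map_prod_map _ _ hT.measurable_mk measurable_id,
    Measure.map_id, ← Measure.map_congr hT.ae_eq_mk]

/-- `E` may be replaced by a measurable set equal to it almost everywhere; the preimages then also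
agree almost everywhere. -/
theorem restrict_map_of_nullMeasurableSet {X Y : Type*} [MeasurableSpace X] [MeasurableSpace Y]
    {ν : Measure Y} {T : Y → X} (hT : AEMeasurable T ν) {E : Set X}
    (hE : NullMeasurableSet E (ν.map T)) :
    NullMeasurableSet (T ⁻¹' E) ν ∧ (ν.restrict (T ⁻¹' E)).map T = (ν.map T).restrict E := by
  obtain ⟨E', -, hE', hEE⟩ := hE.exists_measurable_superset_ae_eq
  have hpre : (T ⁻¹' E' : Set Y) =ᵐ[ν] T ⁻¹' E := ae_of_ae_map hT hEE
  exact ⟨(hT.nullMeasurableSet_preimage hE').congr hpre, by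
    rw [← Measure.restrict_congr_set hEE, ← Measure.restrict_congr_set hpre,
      Measure.restrict_map_of_aemeasurable hT hE']⟩

/-- Adds one variable to a chart. The inverse recovers `x` from the first component by `T`, then `s`
from the second by `rank (ψ x)`; the densities multiply. -/
theorem IsChart.prod_shear {X Y : Type*} [MeasurableSpace X] [MeasurableSpace Y] {μ : Measure X}
    {ν : Measure Y} [SFinite μ] [SFinite ν] {D G : Set X} {W : X → Y} {J : X → ℝ≥0∞}
    (hW : IsChart μ ν D W J) (hJ : AEMeasurable J μ) {ψ : X → ℝ → ℝ} {k : X × ℝ → ℝ≥0∞}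
    (hGD : G ⊆ D) (hG : ∀ᵐ x ∂μ, x ∈ G)
    (hψ : AEMeasurable (Function.uncurry ψ) (μ.prod unitVol))
    (hmono : ∀ x ∈ G, StrictMonoOn (ψ x) (Ioo 0 1)) (hcont : ∀ x ∈ G, ContinuousOn (ψ x) (Ioo 0 1))
    (hk : AEMeasurable k (μ.prod unitVol))
    (hint : ∀ᵐ x ∂μ, ∀ a ∈ Ioo (0 : ℝ) 1, ∀ b ∈ Ioo (0 : ℝ) 1, a < b →
      ∫⁻ s in Ioo a b, k (x, s) = ENNReal.ofReal (ψ x b - ψ x a)) :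
    IsChart (μ.prod unitVol) (ν.prod volume) (G ×ˢ Ioo 0 1) (fun p => (W p.1, ψ p.1 p.2))
      (fun p => J p.1 * k p) := by
  obtain ⟨T, hT, hE, hTm, hmap⟩ := hW
  set E₁ := {p : X × ℝ | p.1 ∈ G ∧ rank (ψ p.1) p.2 ∈ Ioo (0 : ℝ) 1} with hE₁
  set S := fun p : Y × ℝ => (T p.1, p.2) with hS
  set Θ := fun p : X × ℝ => (p.1, rank (ψ p.1) p.2) with hΘ
  -- The range is rewritten as a preimage under the inverse maps, which makes its null measurability
  -- accessible.
  have hrange : (fun p : X × ℝ => (W p.1, ψ p.1 p.2)) '' (G ×ˢ Ioo 0 1)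
      = S ⁻¹' E₁ ∩ (W '' D) ×ˢ univ := by
    ext ⟨y, r⟩
    constructor
    · rintro ⟨⟨x, s⟩, ⟨hx, hs⟩, h⟩
      simp only [Prod.mk.injEq] at h
      obtain ⟨rfl, rfl⟩ := h
      have hxD := hGD hx
      refine ⟨?_, ⟨x, hxD, rfl⟩, mem_univ _⟩
      simp only [hS, hE₁, mem_preimage, mem_ofPred_eq, hT x hxD]
      refine ⟨hx, ?_⟩
      rwa [rank_apply (hmono x hx) hs]
    · rintro ⟨⟨h1, h2⟩, ⟨x, hxD, hxy⟩, -⟩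
      simp only at hxy
      subst hxy
      simp only [hS, hT x hxD] at h1 h2
      obtain ⟨s, hs, hsr⟩ := exists_eq_of_rank_mem (hcont x h1) h2
      exact ⟨(x, s), ⟨h1, hs⟩, by simp [hsr]⟩
  obtain ⟨hSm, hSmap⟩ := map_prodMap_id hTm (volume : Measure ℝ)
  rw [hmap] at hSmap
  -- After `T` the base measure is `μ.withDensity J`; absolute continuity transfers the hypotheses
  -- known for `μ`.
  have hac : μ.withDensity J ≪ μ := withDensity_absolutelyContinuous _ _
  have hac2 : (μ.withDensity J).prod unitVol ≪ μ.prod unitVol :=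
    hac.prod Measure.AbsolutelyContinuous.rfl
  have hE₁n : NullMeasurableSet E₁ ((μ.withDensity J).prod volume) :=
    nullMeasurableSet_shear_range (hac.ae_le hG) (hψ.mono_ac hac2)
  have hprod : (ν.restrict (W '' D)).prod (volume : Measure ℝ)
      = (ν.prod volume).restrict ((W '' D) ×ˢ univ) := by
    rw [← Measure.prod_restrict, Measure.restrict_univ]
  obtain ⟨hpre, hSE⟩ := restrict_map_of_nullMeasurableSet hSm (by rw [hSmap]; exact hE₁n)
  have hrm : AEMeasurable Θ (((μ.withDensity J).prod volume).restrict E₁) :=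
    (measurable_fst.aemeasurable.prodMk (aemeasurable_rank (hψ.mono_ac hac2) volume)).restrict
  have hres : (ν.prod volume).restrict (S ⁻¹' E₁ ∩ (W '' D) ×ˢ univ)
      = ((ν.restrict (W '' D)).prod volume).restrict (S ⁻¹' E₁) := by
    rw [hprod, Measure.restrict_restrict₀ (by rwa [← hprod])]
  refine ⟨Θ ∘ S, ?_, ?_, ?_, ?_⟩
  · rintro ⟨x, s⟩ ⟨hx, hs⟩
    simp [hS, hΘ, hT x (hGD hx), rank_apply (hmono x hx) hs]
  · rw [hrange]
    have hWD : NullMeasurableSet ((W '' D) ×ˢ (univ : Set ℝ)) (ν.prod volume) :=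
      hE.prod nullMeasurableSet_univ
    rw [← nullMeasurableSet_restrict hWD, ← hprod]
    exact hpre
  · rw [hrange, hres]
    exact AEMeasurable.comp_aemeasurable (by rwa [hSE, hSmap]) hSm.restrict
  · rw [hrange, hres, ← AEMeasurable.map_map_of_aemeasurable (by rwa [hSE, hSmap]) hSm.restrict,
      hSE, hSmap, map_shear (hac.ae_le hG) (hψ.mono_ac hac2) hmono hcont (hk.mono_ac hac2)
      (hac.ae_le hint), prod_withDensity_left₀ hJ]
    exact (withDensity_mul₀
      (hJ.comp_quasiMeasurePreserving Measure.quasiMeasurePreserving_fst) hk).symm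

/-! ### One step of the inverse distribution field -/

section Step

variable {Y : Type*} [MeasurableSpace Y] {ν : Measure Y} {M : Y × ℝ → ℝ}

/-- By `idf_lt_iff`, the sublevel sets are inequalities between parametric integrals of `M`, which
can be computed with a measurable version off a null set `B` of parameters. -/
theorem aemeasurable_idf_prod [SFinite ν] (hM : AEMeasurable M (ν.prod volume)) (hM0 : ∀ p, 0 ≤ M p)
    (hadm : ∀ᵐ y ∂ν, Admissible fun r => M (y, r)) :
    AEMeasurable (fun p : Y × ℝ => idf (fun r => M (p.1, r)) p.2) (ν.prod unitVol) := by
  classical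
  have hgood : ∀ᵐ y ∂ν, Admissible (fun r => M (y, r)) ∧
      (fun r => M (y, r)) =ᵐ[volume] fun r => hM.mk M (y, r) :=
    hadm.and (Measure.ae_ae_of_ae_prod hM.ae_eq_mk)
  obtain ⟨B, hBsub, hB, hB0⟩ := exists_measurable_superset_of_null hgood
  have hBgood : ∀ y ∉ B, Admissible (fun r => M (y, r)) ∧
      (fun r => M (y, r)) =ᵐ[volume] fun r => hM.mk M (y, r) := fun y hy => by
    by_contra h
    exact hy (hBsub h)
  have hD : MeasurableSet (Bᶜ ×ˢ Ioo (0 : ℝ) 1) := hB.compl.prod measurableSet_Ioo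
  refine ⟨fun p => if p ∈ Bᶜ ×ˢ Ioo (0 : ℝ) 1 then idf (fun r => M (p.1, r)) p.2 else 0, ?_, ?_⟩
  · refine measurable_of_Iio fun a => ?_
    have hint : ∀ s : Set ℝ, Measurable fun p : Y × ℝ => ∫ r in s, hM.mk M (p.1, r) := fun s =>
      ((hM.measurable_mk.stronglyMeasurable.integral_prod_right'
        (ν := volume.restrict s)).measurable).comp measurable_fst
    have hint' : Measurable fun p : Y × ℝ => ∫ r, hM.mk M (p.1, r) :=
      ((hM.measurable_mk.stronglyMeasurable.integral_prod_right'
        (ν := volume)).measurable).comp measurable_fst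
    -- Off the good set the chosen version is 0, hence the second piece, which is everything or
    -- nothing according to the sign of `a`.
    have hset : (fun p : Y × ℝ => if p ∈ Bᶜ ×ˢ Ioo (0 : ℝ) 1 then idf (fun r => M (p.1, r)) p.2
        else 0) ⁻¹' Iio a = (Bᶜ ×ˢ Ioo (0 : ℝ) 1 ∩
          {p | p.2 * (∫ r, hM.mk M (p.1, r)) < ∫ r in Iic a, hM.mk M (p.1, r)}) ∪
          ((Bᶜ ×ˢ Ioo (0 : ℝ) 1)ᶜ ∩ {_p | 0 < a}) := by
      ext p
      by_cases hp : p ∈ Bᶜ ×ˢ Ioo (0 : ℝ) 1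
      · obtain ⟨h1, h2⟩ := hBgood p.1 hp.1
        simp only [mem_preimage, mem_Iio, hp, if_true, mem_union, mem_inter_iff, mem_compl_iff,
          not_true, false_and, or_false, true_and, mem_ofPred_eq]
        rw [idf_lt_iff h1 (fun r => hM0 _) hp.2, integral_congr_ae h2,
          integral_congr_ae (ae_restrict_of_ae h2)]
      · simp only [mem_preimage, mem_Iio, hp, if_false, mem_union, mem_inter_iff, false_and, false_or,
          mem_compl_iff, not_false_eq_true, true_and, mem_ofPred_eq]
    rw [hset]
    exact (hD.inter (measurableSet_lt (measurable_snd.mul hint') (hint _))).union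
      (hD.compl.inter (MeasurableSet.const _))
  · have h1 : ∀ᵐ p ∂(ν.prod unitVol), p.1 ∉ B :=
      Measure.quasiMeasurePreserving_fst.ae (measure_eq_zero_iff_ae_notMem.1 hB0)
    have h2 : ∀ᵐ p ∂(ν.prod unitVol), p.2 ∈ Ioo (0 : ℝ) 1 :=
      Measure.quasiMeasurePreserving_snd.ae (ae_restrict_mem measurableSet_Ioo)
    filter_upwards [h1, h2] with p hp1 hp2
    rw [if_pos ⟨hp1, hp2⟩]

theorem map_idf_prod [SFinite ν] (hM : AEMeasurable M (ν.prod volume)) (hM0 : ∀ p, 0 ≤ M p)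
    (hadm : ∀ᵐ y ∂ν, Admissible fun r => M (y, r)) :
    (ν.prod unitVol).map (fun p : Y × ℝ => (p.1, idf (fun r => M (p.1, r)) p.2))
      = (ν.prod volume).withDensity fun p => ENNReal.ofReal (M p / ∫ r, M (p.1, r)) := by
  have hΦ : AEMeasurable (fun p : Y × ℝ => (p.1, idf (fun r => M (p.1, r)) p.2))
      (ν.prod unitVol) :=
    measurable_fst.aemeasurable.prodMk (aemeasurable_idf_prod hM hM0 hadm)
  have hmm : AEMeasurable (fun p : Y × ℝ => ∫ r, M (p.1, r)) (ν.prod volume) :=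
    hM.aestronglyMeasurable.integral_prod_right'.aemeasurable.comp_quasiMeasurePreserving
      Measure.quasiMeasurePreserving_fst
  have hd : AEMeasurable (fun p : Y × ℝ => ENNReal.ofReal (M p / ∫ r, M (p.1, r)))
      (ν.prod volume) := (hM.div hmm).ennreal_ofReal
  ext A hA
  have hN := hΦ.nullMeasurableSet_preimage hA
  have h1m : AEMeasurable (1 : Y × ℝ → ℝ≥0∞) (ν.prod unitVol) := measurable_one.aemeasurable
  rw [Measure.map_apply_of_aemeasurable hΦ hA, ← lintegral_indicator_one₀ hN,
    lintegral_prod _ (h1m.indicator₀ hN), withDensity_apply _ hA, ← lintegral_indicator hA,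
    lintegral_prod _ (hd.indicator hA)]
  refine lintegral_congr_ae ?_
  filter_upwards [hadm] with y hy
  have hAy : MeasurableSet (Prod.mk y ⁻¹' A) := measurable_prodMk_left hA
  have hmy := aemeasurable_idf hy fun r => hM0 (y, r)
  have := lintegral_indicator_one₀ (hmy.nullMeasurableSet_preimage hAy)
  rw [← Measure.map_apply_of_aemeasurable hmy hAy, map_idf hy fun r => hM0 (y, r),
    withDensity_apply _ hAy, ← lintegral_indicator hAy] at this
  exact this

/-- Marginal times conditional density: `m / C` for `U`, then `M / m` for the new variable, give `M
/ C`. -/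
theorem map_idfStep {X : Type*} [MeasurableSpace X] {μ : Measure X} [SFinite μ] {U : X → Y}
    {m : Y → ℝ} {C : ℝ} (hC : 0 < C) (hM : AEMeasurable M (ν.prod volume)) (hM0 : ∀ p, 0 ≤ M p)
    (hmarg : ∀ᵐ y ∂ν, Integrable (fun r => M (y, r)) ∧ ∫ r, M (y, r) = m y)
    (hU : AEMeasurable U μ)
    (hUm : μ.map U = ν.withDensity fun y => ENNReal.ofReal (m y / C)) :
    AEMeasurable (fun p : X × ℝ => (U p.1, idf (fun r => M (U p.1, r)) p.2)) (μ.prod unitVol) ∧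
    (μ.prod unitVol).map (fun p : X × ℝ => (U p.1, idf (fun r => M (U p.1, r)) p.2))
      = (ν.prod volume).withDensity fun p => ENNReal.ofReal (M p / C) := by
  have hmm : AEMeasurable m ν :=
    hM.aestronglyMeasurable.integral_prod_right'.aemeasurable.congr (hmarg.mono fun y hy => hy.2)
  have hac : μ.map U ≪ ν := by
    rw [hUm]
    exact withDensity_absolutelyContinuous _ _
  -- The conditional law only makes sense where `m` is positive; the law of `U` does not charge the
  -- other points.
  have hadm : ∀ᵐ y ∂(μ.map U), Admissible fun r => M (y, r) := by
    rw [hUm, ae_withDensity_iff' (hmm.div_const _).ennreal_ofReal]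
    filter_upwards [hmarg] with y hy hne
    refine ⟨hy.1, lt_of_le_of_ne (integral_nonneg fun r => hM0 _) fun h => hne ?_⟩
    rw [← hy.2, ← h]
    simp
  have hM' : AEMeasurable M ((μ.map U).prod volume) :=
    hM.mono_ac (hac.prod Measure.AbsolutelyContinuous.rfl)
  obtain ⟨hSm, hSmap⟩ := map_prodMap_id hU unitVol
  have hΦ : AEMeasurable (fun p : Y × ℝ => (p.1, idf (fun r => M (p.1, r)) p.2))
      ((μ.map U).prod unitVol) :=
    measurable_fst.aemeasurable.prodMk (aemeasurable_idf_prod hM' hM0 hadm)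
  rw [← hSmap] at hΦ
  refine ⟨hΦ.comp_aemeasurable hSm, ?_⟩
  have hcomp := AEMeasurable.map_map_of_aemeasurable hΦ hSm
  rw [hSmap, map_idf_prod hM' hM0 hadm] at hcomp
  refine hcomp.symm.trans ?_
  have hd1 : AEMeasurable (fun p : Y × ℝ => ENNReal.ofReal (m p.1 / C)) (ν.prod volume) :=
    (hmm.div_const _).ennreal_ofReal.comp_quasiMeasurePreserving
      Measure.quasiMeasurePreserving_fst
  have hd2 : AEMeasurable (fun p : Y × ℝ => ENNReal.ofReal (M p / ∫ r, M (p.1, r)))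
      (ν.prod volume) :=
    (hM.div (hM.aestronglyMeasurable.integral_prod_right'.aemeasurable.comp_quasiMeasurePreserving
      Measure.quasiMeasurePreserving_fst)).ennreal_ofReal
  rw [hUm, prod_withDensity_left₀ (hmm.div_const _).ennreal_ofReal, ← withDensity_mul₀ hd1 hd2]
  ext A hA
  rw [withDensity_apply _ hA, withDensity_apply _ hA, ← lintegral_indicator hA,
    ← lintegral_indicator hA, lintegral_prod _ ((hd1.mul hd2).indicator hA),
    lintegral_prod _ ((hM.div_const _).ennreal_ofReal.indicator hA)]
  refine lintegral_congr_ae ?_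
  filter_upwards [hmarg] with y ⟨hi, hy⟩
  have hae : ∀ᵐ r, ENNReal.ofReal (m y / C) * ENNReal.ofReal (M (y, r) / ∫ r, M (y, r))
      = ENNReal.ofReal (M (y, r) / C) := by
    have hm0 : 0 ≤ m y := hy ▸ integral_nonneg fun r => hM0 _
    -- Where `m y = 0` the fibre of `M` vanishes almost everywhere, so both densities are zero
    -- despite the division by zero.
    rcases hm0.eq_or_lt with h | h
    · have hz : (fun r => M (y, r)) =ᵐ[volume] 0 :=
        (integral_eq_zero_iff_of_nonneg (fun r => hM0 _) hi).1 (hy.trans h.symm)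
      filter_upwards [hz] with r hr
      simp only [Pi.zero_apply] at hr
      simp [hr]
    · filter_upwards with r
      rw [hy, ← ENNReal.ofReal_mul (by positivity)]
      congr 1
      field_simp
  refine lintegral_congr_ae ?_
  filter_upwards [hae] with r hr
  simp only [indicator, Pi.mul_apply, hr]

end Step

/-! ### Prefixes of coordinates and marginals -/

theorem measurePreserving_of_sumEquiv {ι κ ξ : Type*} [Fintype ι] [Fintype κ] [Fintype ξ]
    (σ : ι ⊕ κ ≃ ξ) {Γ : (ι → ℝ) × (κ → ℝ) → ξ → ℝ}
    (h : ∀ p a, Γ p (σ a) = Sum.elim p.1 p.2 a) : MeasurePreserving Γ volume volume := by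
  have h1 := (volume_measurePreserving_piCongrLeft (fun _ : ξ => ℝ) σ).comp
    (volume_measurePreserving_sumPiEquivProdPi_symm (fun _ : ι ⊕ κ => ℝ))
  convert h1 using 1
  ext p b
  obtain ⟨a, rfl⟩ := σ.surjective b
  rw [h]
  simp only [Function.comp_apply, MeasurableEquiv.piCongrLeft, MeasurableEquiv.coe_mk,
    Equiv.piCongrLeft_apply_apply]
  cases a <;> rfl

theorem measurePreserving_of_optionEquiv {κ ξ : Type*} [Fintype κ] [Fintype ξ]
    (σ : Unit ⊕ κ ≃ ξ) {Γ : ℝ × (κ → ℝ) → ξ → ℝ}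
    (h : ∀ p a, Γ p (σ a) = Sum.elim (fun _ => p.1) p.2 a) :
    MeasurePreserving Γ volume volume := by
  have h1 := measurePreserving_of_sumEquiv σ (Γ := fun p => Γ (p.1 (), p.2))
    (fun p a => by rw [h])
  have h2 := ((volume_preserving_funUnique Unit ℝ).symm).prod
    (MeasurePreserving.id (volume : Measure (κ → ℝ)))
  exact h1.comp h2

noncomputable section

/-- The measurable equivalence appending a last coordinate. -/
def snocEquiv (k : ℕ) : (Fin k → ℝ) × ℝ ≃ᵐ (Fin (k + 1) → ℝ) :=
  MeasurableEquiv.prodComm.trans (MeasurableEquiv.piFinSuccAbove (fun _ => ℝ) (Fin.last k)).symm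

theorem snocEquiv_castSucc {k : ℕ} (p : (Fin k → ℝ) × ℝ) (j : Fin k) :
    snocEquiv k p j.castSucc = p.1 j := by
  have : snocEquiv k p = (Fin.last k).insertNth (α := fun _ => ℝ) p.2 p.1 := rfl
  rw [this, Fin.insertNth_last']
  simp

theorem snocEquiv_last {k : ℕ} (p : (Fin k → ℝ) × ℝ) : snocEquiv k p (Fin.last k) = p.2 := by
  have : snocEquiv k p = (Fin.last k).insertNth (α := fun _ => ℝ) p.2 p.1 := rfl
  rw [this, Fin.insertNth_last']
  simp

theorem measurePreserving_snocEquiv (k : ℕ) :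
    MeasurePreserving (snocEquiv k) (volume.prod volume) volume :=
  ((volume_preserving_piFinSuccAbove (fun _ : Fin (k + 1) => ℝ) (Fin.last k)).symm).comp
    Measure.measurePreserving_swap

variable {n : ℕ}

/-- Pads a vector of the first `k` coordinates with the value `1/2`. -/
def extend (n : ℕ) {k : ℕ} (x : Fin k → ℝ) : Fin n → ℝ :=
  fun j => if h : j.val < k then x ⟨j, h⟩ else 1 / 2

/-- The coordinates after the first `k`. -/
def tailSet (n k : ℕ) : Finset (Fin n) := Finset.univ.filter fun j => k ≤ j.val

theorem mem_tailSet {k : ℕ} {j : Fin n} : j ∈ tailSet n k ↔ k ≤ j.val := by simp [tailSet]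

/-- Joins the first `k` coordinates with the remaining ones. -/
def glue (n k : ℕ) (p : (Fin k → ℝ) × (tailSet n k → ℝ)) : Fin n → ℝ :=
  Function.updateFinset (extend n p.1) (tailSet n k) p.2

/-- The marginal of `F` on the first `k` coordinates. -/
def marginal (F : (Fin n → ℝ) → ℝ) (k : ℕ) (x : Fin k → ℝ) : ℝ :=
  ∫ y : tailSet n k → ℝ, F (glue n k (x, y))

theorem glue_lt {k : ℕ} (p : (Fin k → ℝ) × (tailSet n k → ℝ)) {j : Fin n} (h : j.val < k) :
    glue n k p j = p.1 ⟨j, h⟩ := by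
  have : j ∉ tailSet n k := by rw [mem_tailSet]; omega
  simp [glue, Function.updateFinset, this, extend, h]

theorem glue_ge {k : ℕ} (p : (Fin k → ℝ) × (tailSet n k → ℝ)) (j : tailSet n k) :
    glue n k p j = p.2 j := by
  simp [glue, Function.updateFinset]

theorem measurePreserving_glue {k : ℕ} (hk : k ≤ n) :
    MeasurePreserving (glue n k) volume volume := by
  have hbij : Function.Bijective
      (Sum.elim (Fin.castLE hk) Subtype.val : Fin k ⊕ tailSet n k → Fin n) := by
    constructor
    · rintro (a | a) (b | b) hab
      · simpa using hab
      · have h1 := mem_tailSet.1 b.2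
        have h2 := a.2
        have h3 := congrArg Fin.val hab
        simp at h3
        omega
      · have h1 := mem_tailSet.1 a.2
        have h2 := b.2
        have h3 := congrArg Fin.val hab
        simp at h3
        omega
      · exact congrArg Sum.inr (Subtype.ext hab)
    · intro j
      by_cases h : j.val < k
      · exact ⟨Sum.inl ⟨j, h⟩, rfl⟩
      · exact ⟨Sum.inr ⟨j, mem_tailSet.2 (not_lt.1 h)⟩, rfl⟩
  refine measurePreserving_of_sumEquiv (Equiv.ofBijective _ hbij) fun p a => ?_
  rcases a with a | a
  · exact glue_lt p a.2
  · exact glue_ge p a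

/-- Joins the coordinate `k` with the later ones. -/
def glueTail (n k : ℕ) (p : ℝ × (tailSet n (k + 1) → ℝ)) (j : tailSet n k) : ℝ :=
  if h : k + 1 ≤ j.1.val then p.2 ⟨j, mem_tailSet.2 h⟩ else p.1

theorem measurePreserving_glueTail {k : ℕ} (hk : k < n) :
    MeasurePreserving (glueTail n k) volume volume := by
  have hbij : Function.Bijective
      (Sum.elim (fun _ => ⟨⟨k, hk⟩, mem_tailSet.2 le_rfl⟩)
        (fun j => ⟨j.1, mem_tailSet.2 ((Nat.le_succ k).trans (mem_tailSet.1 j.2))⟩) :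
        Unit ⊕ tailSet n (k + 1) → tailSet n k) := by
    constructor
    · rintro (a | a) (b | b) hab
      · rfl
      · have h1 := mem_tailSet.1 b.2
        have h3 := congrArg (fun j : tailSet n k => j.1.val) hab
        simp at h3
        omega
      · have h1 := mem_tailSet.1 a.2
        have h3 := congrArg (fun j : tailSet n k => j.1.val) hab
        simp at h3
        omega
      · have h3 := congrArg (fun j : tailSet n k => j.1) hab
        exact congrArg Sum.inr (Subtype.ext h3)
    · intro j
      by_cases h : k + 1 ≤ j.1.val
      · exact ⟨Sum.inr ⟨j.1, mem_tailSet.2 h⟩, rfl⟩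
      · have := mem_tailSet.1 j.2
        refine ⟨Sum.inl (), Subtype.ext (Fin.ext ?_)⟩
        simp
        omega
  refine measurePreserving_of_optionEquiv (Equiv.ofBijective _ hbij) fun p a => ?_
  rcases a with a | a
  · simp [glueTail]
  · have := mem_tailSet.1 a.2
    simp [glueTail, this]

theorem glue_glueTail {k : ℕ} (x : Fin k → ℝ) (p : ℝ × (tailSet n (k + 1) → ℝ)) :
    glue n k (x, glueTail n k p) = glue n (k + 1) (snocEquiv k (x, p.1), p.2) := by
  ext j
  rcases lt_trichotomy j.val k with h | h | h
  · rw [glue_lt _ h, glue_lt _ (h.trans (Nat.lt_succ_self k))]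
    exact (snocEquiv_castSucc (x, p.1) ⟨j, h⟩).symm
  · rw [glue_ge _ (⟨j, mem_tailSet.2 h.ge⟩ : tailSet n k), glue_lt _ (by omega : j.val < k + 1)]
    have h2 : (⟨j.val, by omega⟩ : Fin (k + 1)) = Fin.last k := Fin.ext h
    have h3 := snocEquiv_last (x, p.1)
    rw [← h2] at h3
    refine Eq.trans ?_ h3.symm
    simp only [glueTail]
    rw [dif_neg (by omega)]
  · rw [glue_ge _ (⟨j, mem_tailSet.2 h.le⟩ : tailSet n k),
      glue_ge _ (⟨j, mem_tailSet.2 h⟩ : tailSet n (k + 1))]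
    simp only [glueTail]
    rw [dif_pos (by omega)]

theorem aemeasurable_marginal {F : (Fin n → ℝ) → ℝ} (hF : Integrable F) {k : ℕ} (hk : k ≤ n) :
    AEMeasurable (marginal F k) volume :=
  (((measurePreserving_glue hk).integrable_comp_of_integrable
    hF).aestronglyMeasurable.integral_prod_right').aemeasurable

theorem marginal_nonneg {F : (Fin n → ℝ) → ℝ} (hF : ∀ x, 0 ≤ F x) {k : ℕ} (x : Fin k → ℝ) :
    0 ≤ marginal F k x :=
  integral_nonneg fun _ => hF _

/-- Fubini in the variables from `k` on, with coordinate `k` split off by `glueTail`. -/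
theorem integral_marginal_succ {F : (Fin n → ℝ) → ℝ} (hF : Integrable F) {k : ℕ} (hk : k < n) :
    ∀ᵐ x : Fin k → ℝ, Integrable (fun s => marginal F (k + 1) (snocEquiv k (x, s))) ∧
      ∫ s, marginal F (k + 1) (snocEquiv k (x, s)) = marginal F k x := by
  filter_upwards [((measurePreserving_glue hk.le).integrable_comp_of_integrable hF).prod_right_ae]
    with x hx
  have hmp := measurePreserving_glueTail hk
  have hint : Integrable (fun p : ℝ × (tailSet n (k + 1) → ℝ) =>
      F (glue n (k + 1) (snocEquiv k (x, p.1), p.2))) (volume.prod volume) := by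
    have := hmp.integrable_comp_of_integrable hx
    refine this.congr (Eventually.of_forall fun p => ?_)
    simp [Function.comp, glue_glueTail]
  refine ⟨hint.integral_prod_left, ?_⟩
  have h1 := integral_prod _ hint
  simp only [marginal]
  rw [← h1, ← hmp.map_eq, integral_map hmp.measurable.aemeasurable
    (by rw [hmp.map_eq]; exact hx.aestronglyMeasurable)]
  simp only [glue_glueTail]
  rfl

theorem marginal_zero {F : (Fin n → ℝ) → ℝ} (hF : Integrable F) (x : Fin 0 → ℝ) :
    marginal F 0 x = ∫ y, F y := by
  have hmp := measurePreserving_glue (Nat.zero_le n)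
  rw [← hmp.map_eq, integral_map hmp.measurable.aemeasurable
    (by rw [hmp.map_eq]; exact hF.aestronglyMeasurable)]
  have h1 := integral_prod _ (hmp.integrable_comp_of_integrable hF)
  refine Eq.trans ?_ h1.symm
  rw [volume_pi, Measure.pi_of_empty _ x, integral_dirac]
  rfl

theorem marginal_self (F : (Fin n → ℝ) → ℝ) (x : Fin n → ℝ) : marginal F n x = F x := by
  have : IsEmpty (tailSet n n) := ⟨fun j => absurd (mem_tailSet.1 j.2) (not_le.2 j.1.2)⟩
  rw [marginal, volume_pi, Measure.pi_of_empty _ (fun _ => 0), integral_dirac]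
  congr 1
  ext j
  rw [glue_lt _ j.2]

/-! ### The unit cube -/

theorem cube_eq_pi (k : ℕ) : cube k = univ.pi fun _ => Ioo (0 : ℝ) 1 := by
  ext t
  simp [cube]

theorem measurableSet_cube (k : ℕ) : MeasurableSet (cube k) := by
  rw [cube_eq_pi]
  exact MeasurableSet.univ_pi fun _ => measurableSet_Ioo

/-- Lebesgue measure on the unit cube. -/
abbrev cubeVol (k : ℕ) : Measure (Fin k → ℝ) := volume.restrict (cube k)

theorem volume_unitBox (κ : Type*) [Fintype κ] :
    volume (univ.pi fun _ : κ => Ioo (0 : ℝ) 1) = 1 := by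
  rw [volume_pi_pi]
  simp

instance (k : ℕ) : IsProbabilityMeasure (cubeVol k) :=
  ⟨by rw [Measure.restrict_apply_univ, cube_eq_pi, volume_unitBox]⟩

theorem snocEquiv_mem_cube {k : ℕ} {p : (Fin k → ℝ) × ℝ} :
    snocEquiv k p ∈ cube (k + 1) ↔ p.1 ∈ cube k ∧ p.2 ∈ Ioo (0 : ℝ) 1 := by
  simp only [cube, mem_ofPred_eq, Fin.forall_fin_succ', snocEquiv_castSucc, snocEquiv_last]

theorem measurePreserving_snocEquiv_cube (k : ℕ) :
    MeasurePreserving (snocEquiv k) ((cubeVol k).prod unitVol) (cubeVol (k + 1)) := by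
  have h := (measurePreserving_snocEquiv k).restrict_preimage (measurableSet_cube (k + 1))
  have hset : snocEquiv k ⁻¹' cube (k + 1) = cube k ×ˢ Ioo (0 : ℝ) 1 := by
    ext p
    exact snocEquiv_mem_cube
  rwa [hset, ← Measure.prod_restrict] at h

theorem measurePreserving_glue_cube {k : ℕ} (hk : k ≤ n) :
    MeasurePreserving (glue n k)
      ((cubeVol k).prod (volume.restrict (univ.pi fun _ => Ioo (0 : ℝ) 1))) (cubeVol n) := by
  have h := (measurePreserving_glue hk).restrict_preimage (measurableSet_cube n)
  have hset : glue n k ⁻¹' cube n = cube k ×ˢ (univ.pi fun _ => Ioo (0 : ℝ) 1) := by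
    ext p
    simp only [mem_preimage, mem_prod, cube, mem_ofPred_eq, mem_univ_pi]
    constructor
    · intro hp
      refine ⟨fun i => ?_, fun i => ?_⟩
      · have := hp (Fin.castLE hk i)
        rwa [glue_lt p (j := Fin.castLE hk i) i.2] at this
      · rw [← glue_ge p i]
        exact hp i
    · rintro ⟨h1, h2⟩ j
      by_cases hj : j.val < k
      · rw [glue_lt p hj]
        exact h1 _
      · have := h2 ⟨j, mem_tailSet.2 (not_lt.1 hj)⟩
        rwa [← glue_ge p] at this
  rwa [hset, Measure.volume_eq_prod, ← Measure.prod_restrict] at h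

theorem neZero_unitBox (κ : Type*) [Fintype κ] :
    NeZero (volume.restrict (univ.pi fun _ : κ => Ioo (0 : ℝ) 1)) :=
  ⟨fun h => by
    have := congrArg (fun m => m univ) h
    simp only [Measure.restrict_apply_univ, volume_unitBox] at this
    simp at this⟩

/-- A property of almost every point of the cube which depends on the first `k` coordinates only
holds for almost every point of the cube of dimension `k`. -/
theorem ae_cube_of_prefix {k : ℕ} (hk : k ≤ n) {P : (Fin n → ℝ) → Prop} {Q : (Fin k → ℝ) → Prop}
    (hP : ∀ᵐ t ∂(cubeVol n), P t)
    (hPQ : ∀ t ∈ cube n, P t → Q fun j => t (Fin.castLE hk j)) : ∀ᵐ x ∂(cubeVol k), Q x := by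
  have hmp := measurePreserving_glue_cube hk
  have h1 : ∀ᵐ t ∂(cubeVol n), Q fun j => t (Fin.castLE hk j) := by
    filter_upwards [hP, ae_restrict_mem (measurableSet_cube n)] with t h1 h2 using hPQ t h2 h1
  have h2 := Measure.ae_ae_of_ae_prod (hmp.quasiMeasurePreserving.ae h1)
  have := neZero_unitBox (tailSet n k)
  filter_upwards [h2] with x hx
  -- The remaining coordinates carry a nonzero measure, so some completion of `x` has the property.
  obtain ⟨y, hy⟩ := hx.exists
  convert hy using 2 with j
  exact (glue_lt (x, y) (j := Fin.castLE hk j) j.2).symm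

theorem aemeasurable_cube_of_prefix {k : ℕ} (hk : k ≤ n) {ω : (Fin n → ℝ) → ℝ}
    {ω' : (Fin k → ℝ) → ℝ} (hω : AEMeasurable ω (cubeVol n))
    (h : ∀ t ∈ cube n, ω t = ω' fun j => t (Fin.castLE hk j)) : AEMeasurable ω' (cubeVol k) := by
  have hmp := measurePreserving_glue_cube hk
  have h1 : AEMeasurable (fun t : Fin n → ℝ => ω' fun j => t (Fin.castLE hk j)) (cubeVol n) :=
    hω.congr (by
      filter_upwards [ae_restrict_mem (measurableSet_cube n)] with t h1 using h t h1)
  have h2 := (h1.comp_quasiMeasurePreserving hmp.quasiMeasurePreserving).nullMeasurable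
  have h3 : ((fun t : Fin n → ℝ => ω' fun j => t (Fin.castLE hk j)) ∘ glue n k)
      = ω' ∘ Prod.fst := by
    ext p
    simp only [Function.comp]
    congr 1
    ext j
    exact glue_lt p (j := Fin.castLE hk j) j.2
  rw [h3] at h2
  have := neZero_unitBox (tailSet n k)
  exact (Measure.nullMeasurable_comp_fst.1 h2).aemeasurable

end

noncomputable section

variable {n : ℕ}

/-! ### The fields and the potential on prefixes of coordinates -/

/-- The first `k` coordinates of a vector. -/
def initial {k : ℕ} (hk : k ≤ n) (t : Fin n → ℝ) : Fin k → ℝ := fun j => t (Fin.castLE hk j)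

theorem initial_extend {k : ℕ} (hk : k ≤ n) (x : Fin k → ℝ) : initial hk (extend n x) = x := by
  ext j
  simp [initial, extend]

theorem extend_self (t : Fin n → ℝ) : extend n t = t := by
  ext j
  simp [extend]

theorem initial_self (t : Fin n → ℝ) : initial le_rfl t = t := rfl

theorem initial_initial {k l : ℕ} (hk : k ≤ l) (hl : l ≤ n) (t : Fin n → ℝ) :
    initial hk (initial hl t) = initial (hk.trans hl) t := rfl

theorem initial_snocEquiv {k : ℕ} (p : (Fin k → ℝ) × ℝ) :
    initial (Nat.le_succ k) (snocEquiv k p) = p.1 := by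
  ext j
  exact snocEquiv_castSucc p j

theorem snocEquiv_initial {k : ℕ} (hk : k < n) (t : Fin n → ℝ) :
    snocEquiv k (initial hk.le t, t ⟨k, hk⟩) = initial (Nat.succ_le_of_lt hk) t := by
  ext j
  refine Fin.lastCases ?_ (fun j => ?_) j
  · rw [snocEquiv_last]
    rfl
  · rw [snocEquiv_castSucc]
    rfl

theorem initial_mem_cube {k : ℕ} (hk : k ≤ n) {t : Fin n → ℝ} (ht : t ∈ cube n) :
    initial hk t ∈ cube k := fun _ => ht _

theorem extend_mem_cube {k : ℕ} {x : Fin k → ℝ} (hx : x ∈ cube k) : extend n x ∈ cube n := by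
  intro j
  by_cases h : j.val < k
  · simpa [extend, h] using hx ⟨j, h⟩
  · simp only [extend, h, dif_neg, not_false_eq_true]
    norm_num

variable (z : Fin n → Fin n → ℝ) (f g : (Fin n → ℝ) → ℝ)

/-- The finsets are kept as variables because the type of `y` depends on them; substitution then
avoids a transport. -/
theorem integral_updateFinset_congr (F : (Fin n → ℝ) → ℝ) {S S' : Finset (Fin n)} (hS : S = S')
    {c c' : Fin n → ℝ} (h : ∀ j ∉ S', c j = c' j) :
    ∫ y : S → ℝ, F (Function.updateFinset c S y) = ∫ y : S' → ℝ, F (Function.updateFinset c' S' y)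
    := by
  subst hS
  congr 1
  ext y
  congr 1
  ext j
  by_cases hj : j ∈ S
  · simp [Function.updateFinset, hj]
  · simp [Function.updateFinset, hj, h j hj]

theorem sliceMarginal_eq {k : ℕ} (hk : k < n) (c : Fin n → ℝ) :
    sliceMarginal z f ⟨k, hk⟩ c
      = fun s => marginal (f ∘ combo z) (k + 1) (snocEquiv k (initial hk.le c, s)) := by
  ext s
  refine integral_updateFinset_congr (f ∘ combo z) (S := Finset.Ioi ⟨k, hk⟩)
    (S' := tailSet n (k + 1)) (c := Function.update c ⟨k, hk⟩ s)
    (c' := extend n (snocEquiv k (initial hk.le c, s))) ?_ fun j hj => ?_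
  · ext j
    rw [mem_tailSet, Finset.mem_Ioi, Fin.lt_def]
    rfl
  · rw [mem_tailSet] at hj
    have hj' : j.val < k + 1 := by omega
    simp only [extend, hj', dif_pos]
    rcases Nat.lt_succ_iff_lt_or_eq.1 hj' with h | h
    · have h1 := snocEquiv_castSucc (initial hk.le c, s) ⟨j, h⟩
      refine Eq.trans ?_ h1.symm
      rw [Function.update_of_ne (fun e => by rw [e] at h; exact lt_irrefl _ h)]
      rfl
    · have h1 := snocEquiv_last (initial hk.le c, s)
      have h2 : j = ⟨k, hk⟩ := Fin.ext h
      subst h2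
      rw [Function.update_self]
      exact h1.symm

theorem idCoord_congr {t t' : Fin n → ℝ} (i : Fin n) (h : ∀ j ≤ i, t j = t' j) :
    idCoord z f t i = idCoord z f t' i := by
  induction i using WellFoundedLT.induction with
  | _ i ih =>
    rw [idCoord, idCoord, h i le_rfl]
    congr 2
    ext j
    split_ifs with hj
    · exact ih j hj fun l hl => h l (hl.trans hj.le)
    · rfl

/-- The first `k` components of the inverse distribution field, as a function of the first `k`
variables. -/
def fieldPrefix {k : ℕ} (hk : k ≤ n) (x : Fin k → ℝ) : Fin k → ℝ :=
  initial hk (idCoord z f (extend n x))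

theorem initial_idCoord {k : ℕ} (hk : k ≤ n) (t : Fin n → ℝ) :
    initial hk (idCoord z f t) = fieldPrefix z f hk (initial hk t) := by
  ext j
  refine idCoord_congr z f _ fun l hl => ?_
  have : l.val < k := lt_of_le_of_lt hl j.2
  simp [extend, this, initial]

/-- The marginal density whose inverse distribution function is the component `k` of the inverse
distribution field. -/
def stepDensity {k : ℕ} (hk : k < n) (x : Fin k → ℝ) (r : ℝ) : ℝ :=
  marginal (f ∘ combo z) (k + 1) (snocEquiv k (fieldPrefix z f hk.le x, r))

theorem sliceMarginal_idCoord {k : ℕ} (hk : k < n) (t : Fin n → ℝ) :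
    sliceMarginal z f ⟨k, hk⟩ (idCoord z f t) = stepDensity z f hk (initial hk.le t) := by
  rw [sliceMarginal_eq, initial_idCoord]
  rfl

/-- The recursion sets the components from `k` on to 0, but the slice marginal ignores them. -/
theorem idCoord_eq {k : ℕ} (hk : k < n) (t : Fin n → ℝ) :
    idCoord z f t ⟨k, hk⟩ = idf (stepDensity z f hk (initial hk.le t)) (t ⟨k, hk⟩) := by
  rw [idCoord, ← sliceMarginal_idCoord, sliceMarginal_eq, sliceMarginal_eq]
  congr 4
  ext s
  congr 3
  ext j
  have : Fin.castLE hk.le j < ⟨k, hk⟩ := j.2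
  simp [initial, this]

/-- The triangular structure in the form used by the inductions: one more variable adds one inverse
distribution function over the previous prefix. -/
theorem fieldPrefix_snocEquiv {k : ℕ} (hk : k < n) (p : (Fin k → ℝ) × ℝ) :
    fieldPrefix z f (Nat.succ_le_of_lt hk) (snocEquiv k p)
      = snocEquiv k (fieldPrefix z f hk.le p.1, idf (stepDensity z f hk p.1) p.2) := by
  set t := extend n (snocEquiv k p) with ht
  have h1 : initial (Nat.succ_le_of_lt hk) t = snocEquiv k p := initial_extend _ _
  have h2 : initial hk.le t = p.1 := by
    rw [← initial_initial (Nat.le_succ k) (Nat.succ_le_of_lt hk), h1, initial_snocEquiv]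
  have h3 : t ⟨k, hk⟩ = p.2 := by
    rw [← snocEquiv_last p, ← h1]
    rfl
  rw [fieldPrefix, ← ht, ← snocEquiv_initial hk, initial_idCoord, idCoord_eq, h2, h3]

variable (lam : ℝ) (w : Fin n → (Fin n → ℝ) → ℝ)

/-- The component `k` of the potential as a function of the first `k + 1` variables. -/
def stepPotential {k : ℕ} (hk : k < n) (x : Fin k → ℝ) (s : ℝ) : ℝ :=
  w ⟨k, hk⟩ (extend n (snocEquiv k (x, s)))

/-- The first `k` components of the potential, as a function of the first `k` variables. -/
def potPrefix {k : ℕ} (hk : k ≤ n) (x : Fin k → ℝ) : Fin k → ℝ :=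
  fun j => w (Fin.castLE hk j) (extend n x)

/-- The first `k` variables for which the step `k` of the construction makes sense. -/
def stepGood {k : ℕ} (hk : k < n) : Set (Fin k → ℝ) :=
  {x | Admissible (stepDensity z f hk x) ∧ Admissible (stepDensity z g hk x) ∧
    IsGeomPrimitive lam (idf (stepDensity z f hk x)) (idf (stepDensity z g hk x))
      (stepPotential w hk x)}

/-- The first `k` variables for which the steps before `k` of the construction make sense. -/
def prefixDomain {k : ℕ} (hk : k ≤ n) : Set (Fin k → ℝ) :=
  {x | x ∈ cube k ∧ ∀ j (hj : j < k), initial hj.le x ∈ stepGood z f g lam w (hj.trans_le hk)}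

variable {z f g lam w}

theorem potential_eq (hw : IsGeomPotential z f g lam w) {k : ℕ} (hk : k < n) {t : Fin n → ℝ}
    (ht : t ∈ cube n) : w ⟨k, hk⟩ t = stepPotential w hk (initial hk.le t) (t ⟨k, hk⟩) := by
  rw [stepPotential, snocEquiv_initial]
  refine hw.triangular _ _ ht _ (extend_mem_cube (initial_mem_cube _ ht)) fun j hj => ?_
  have : j.val < k + 1 := Nat.lt_succ_of_le hj
  simp [extend, this, initial]

theorem isPrimitiveAt_iff (hw : IsGeomPotential z f g lam w) {k : ℕ} (hk : k < n)
    {t : Fin n → ℝ} (ht : t ∈ cube n) : IsPrimitiveAt z f g lam w ⟨k, hk⟩ t ↔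
      IsGeomPrimitive lam (idf (stepDensity z f hk (initial hk.le t)))
        (idf (stepDensity z g hk (initial hk.le t)))
        (stepPotential w hk (initial hk.le t)) := by
  have hinit : ∀ s, initial hk.le (Function.update t ⟨k, hk⟩ s) = initial hk.le t := fun s => by
    ext j
    have : Fin.castLE hk.le j ≠ ⟨k, hk⟩ := fun e => absurd (congrArg Fin.val e) j.2.ne
    simp [initial, this]
  have h1 : ∀ h, (fun s => idCoord z h (Function.update t ⟨k, hk⟩ s) ⟨k, hk⟩)
      = idf (stepDensity z h hk (initial hk.le t)) := fun h => by
    ext s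
    rw [idCoord_eq, hinit, Function.update_self]
  have h2 : ∀ s ∈ Ioo (0 : ℝ) 1, w ⟨k, hk⟩ (Function.update t ⟨k, hk⟩ s)
      = stepPotential w hk (initial hk.le t) s := fun s hs => by
    rw [potential_eq hw hk, hinit, Function.update_self]
    intro j
    by_cases hj : j = ⟨k, hk⟩
    · subst hj
      simpa using hs
    · simpa [hj] using ht j
  rw [IsPrimitiveAt, h1, h1, IsGeomPrimitive, IsGeomPrimitive]
  exact exists_congr fun c => forall₂_congr fun s hs => by rw [h2 s hs]

theorem domain_eq (hw : IsGeomPotential z f g lam w) :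
    domain z f g lam w = prefixDomain z f g lam w le_rfl := by
  ext t
  refine and_congr_right fun ht => ?_
  constructor
  · intro h j hj
    obtain ⟨h1, h2, h3⟩ := h ⟨j, hj⟩
    rw [sliceMarginal_idCoord] at h1 h2
    exact ⟨h1, h2, (isPrimitiveAt_iff hw hj ht).1 h3⟩
  · intro h i
    obtain ⟨h1, h2, h3⟩ := h i.1 i.2
    refine ⟨?_, ?_, (isPrimitiveAt_iff hw i.2 ht).2 h3⟩
    · rw [show i = ⟨i.1, i.2⟩ from rfl, sliceMarginal_idCoord]
      exact h1
    · rw [show i = ⟨i.1, i.2⟩ from rfl, sliceMarginal_idCoord]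
      exact h2

/-- The conditions at step `k` do not involve the variable `k` itself, hence the product form
required by `IsChart.prod_shear`. -/
theorem prefixDomain_succ {k : ℕ} (hk : k < n) :
    prefixDomain z f g lam w (Nat.succ_le_of_lt hk) = snocEquiv k ''
      ((prefixDomain z f g lam w hk.le ∩ stepGood z f g lam w hk) ×ˢ Ioo 0 1) := by
  ext x
  obtain ⟨p, rfl⟩ := (snocEquiv k).surjective x
  rw [(snocEquiv k).injective.mem_set_image]
  simp only [prefixDomain, mem_ofPred_eq, snocEquiv_mem_cube, mem_prod, mem_inter_iff]
  have hin : ∀ j (hj : j ≤ k), initial (hj.trans (Nat.le_succ k)) (snocEquiv k p)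
      = initial hj p.1 := fun j hj => by
    rw [← initial_initial hj (Nat.le_succ k), initial_snocEquiv]
  constructor
  · rintro ⟨⟨h1, h2⟩, h3⟩
    refine ⟨⟨⟨h1, fun j hj => ?_⟩, ?_⟩, h2⟩
    · rw [← hin j hj.le]
      exact h3 j (hj.trans (Nat.lt_succ_self k))
    · have := h3 k (Nat.lt_succ_self k)
      rwa [hin k le_rfl] at this
  · rintro ⟨⟨⟨h1, h3⟩, h4⟩, h2⟩
    refine ⟨⟨h1, h2⟩, fun j hj => ?_⟩
    rw [hin j (Nat.lt_succ_iff.1 hj)]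
    rcases Nat.lt_succ_iff_lt_or_eq.1 hj with h | h
    · exact h3 j h
    · subst h
      exact h4

theorem potPrefix_snocEquiv (hw : IsGeomPotential z f g lam w) {k : ℕ} (hk : k < n)
    {p : (Fin k → ℝ) × ℝ} (hp : p.1 ∈ cube k) (hs : p.2 ∈ Ioo (0 : ℝ) 1) :
    potPrefix w (Nat.succ_le_of_lt hk) (snocEquiv k p)
      = snocEquiv k (potPrefix w hk.le p.1, stepPotential w hk p.1 p.2) := by
  ext j
  refine Fin.lastCases ?_ (fun j => ?_) j
  · rw [snocEquiv_last]
    rfl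
  · rw [snocEquiv_castSucc]
    refine hw.triangular _ _ (extend_mem_cube (snocEquiv_mem_cube.2 ⟨hp, hs⟩)) _
      (extend_mem_cube hp) fun l hl => ?_
    have hl' : l.val < k := lt_of_le_of_lt hl j.2
    have hl'' : l.val < k + 1 := hl'.trans (Nat.lt_succ_self k)
    simp only [extend, hl', hl'', dif_pos]
    exact snocEquiv_castSucc p ⟨l, hl'⟩

theorem aemeasurable_stepPotential (hw : IsGeomPotential z f g lam w) {k : ℕ} (hk : k < n) :
    AEMeasurable (Function.uncurry (stepPotential w hk)) ((cubeVol k).prod unitVol) := by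
  have h1 : AEMeasurable (fun x : Fin (k + 1) → ℝ => w ⟨k, hk⟩ (extend n x)) (cubeVol (k + 1)) := by
    refine aemeasurable_cube_of_prefix (Nat.succ_le_of_lt hk) (hw.measurable ⟨k, hk⟩)
      fun t ht => ?_
    rw [potential_eq hw hk ht, stepPotential, snocEquiv_initial]
    rfl
  exact h1.comp_quasiMeasurePreserving (measurePreserving_snocEquiv_cube k).quasiMeasurePreserving

theorem ae_isGeomPrimitive (hw : IsGeomPotential z f g lam w) {k : ℕ} (hk : k < n) :
    ∀ᵐ x ∂(cubeVol k), IsGeomPrimitive lam (idf (stepDensity z f hk x))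
      (idf (stepDensity z g hk x)) (stepPotential w hk x) :=
  ae_cube_of_prefix hk.le (hw.primitive ⟨k, hk⟩) fun _ ht h => (isPrimitiveAt_iff hw hk ht).1 h

end

/-! ### Transport along measure preserving equivalences -/

section Transport

variable {A A' B B' : Type*} [MeasurableSpace A] [MeasurableSpace A'] [MeasurableSpace B]
  [MeasurableSpace B']

theorem map_withDensity_equiv {μ : Measure A} {μ' : Measure A'} (e : A ≃ᵐ A')
    (he : MeasurePreserving e μ μ') (d : A' → ℝ≥0∞) :
    (μ.withDensity fun x => d (e x)).map e = μ'.withDensity d := by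
  ext S hS
  rw [Measure.map_apply e.measurable hS, withDensity_apply _ (e.measurable hS),
    withDensity_apply _ hS, he.setLIntegral_comp_preimage_emb e.measurableEmbedding]

theorem IsChart.congr_density {μ : Measure A} {ν : Measure B} {D : Set A} {W : A → B}
    {J J' : A → ℝ≥0∞} (h : IsChart μ ν D W J) (hJ : J =ᵐ[μ] J') : IsChart μ ν D W J' := by
  obtain ⟨T, h1, h2, h3, h4⟩ := h
  exact ⟨T, h1, h2, h3, h4.trans (withDensity_congr_ae hJ)⟩

theorem IsChart.transport {μ : Measure A} {ν : Measure B} {μ' : Measure A'} {ν' : Measure B'}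
    {D : Set A} {W : A → B} {W' : A' → B'} {J : A' → ℝ≥0∞} (e : A ≃ᵐ A') (e' : B ≃ᵐ B')
    (he : MeasurePreserving e μ μ') (he' : MeasurePreserving e' ν ν')
    (h : IsChart μ ν D W fun x => J (e x)) (hW : ∀ x ∈ D, W' (e x) = e' (W x)) :
    IsChart μ' ν' (e '' D) W' J := by
  obtain ⟨T, h1, h2, h3, h4⟩ := h
  have hrange : W' '' (e '' D) = e'.symm ⁻¹' (W '' D) := by
    rw [← e'.image_eq_preimage_symm, image_image, image_image]
    exact image_congr hW
  have hres : ν'.restrict (W' '' (e '' D)) = (ν.restrict (W '' D)).map e' := by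
    rw [hrange, ← he'.map_eq, e'.restrict_map]
    congr 2
    ext x
    simp
  have hT : AEMeasurable (T ∘ e'.symm) ((ν.restrict (W '' D)).map e') := by
    refine AEMeasurable.comp_aemeasurable ?_ e'.symm.measurable.aemeasurable
    rwa [Measure.map_map e'.symm.measurable e'.measurable, e'.symm_comp_self, Measure.map_id]
  refine ⟨e ∘ T ∘ e'.symm, ?_, ?_, ?_, ?_⟩
  · rintro _ ⟨x, hx, rfl⟩
    simp [hW x hx, h1 x hx]
  · rw [hrange]
    exact h2.preimage (he'.symm e').quasiMeasurePreserving
  · rw [hres]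
    exact e.measurable.comp_aemeasurable hT
  · rw [hres, ← AEMeasurable.map_map_of_aemeasurable e.measurable.aemeasurable hT,
      AEMeasurable.map_map_of_aemeasurable hT e'.measurable.aemeasurable]
    have : (T ∘ e'.symm) ∘ e' = T := by
      ext x
      simp
    rw [this, h4, map_withDensity_equiv e he]

end Transport

noncomputable section

variable {n : ℕ} {z : Fin n → Fin n → ℝ} {f g : (Fin n → ℝ) → ℝ}

/-! ### Law of the inverse distribution field -/

theorem cubeVol_zero : cubeVol 0 = volume := by
  have : cube 0 = univ := by
    ext t
    simp [cube]
  rw [cubeVol, this, Measure.restrict_univ]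

/-- The induction starts from the total mass, normalised to 1, and each step is `map_idfStep` with
consecutive marginals. For `k = n` the field has law f/∫f in the coordinates of `z`. -/
theorem map_fieldPrefix (hF0 : ∀ x, 0 ≤ f x) (hF : Integrable (f ∘ combo z))
    (hC : 0 < ∫ c, f (combo z c)) {k : ℕ} (hk : k ≤ n) :
    AEMeasurable (fieldPrefix z f hk) (cubeVol k) ∧
    (cubeVol k).map (fieldPrefix z f hk) = volume.withDensity fun x =>
      ENNReal.ofReal (marginal (f ∘ combo z) k x / ∫ c, f (combo z c)) := by
  induction k with
  | zero =>
    have h1 : fieldPrefix z f hk = id := Subsingleton.elim _ _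
    have h3 : ∀ x : Fin 0 → ℝ, marginal (f ∘ combo z) 0 x / ∫ c, f (combo z c) = 1 := fun x => by
      rw [marginal_zero hF]
      exact div_self hC.ne'
    refine ⟨by rw [h1]; exact aemeasurable_id, ?_⟩
    simp only [h1, h3, cubeVol_zero, Measure.map_id, ENNReal.ofReal_one]
    exact withDensity_one.symm
  | succ k ih =>
    obtain ⟨hm, hmap⟩ := ih (Nat.le_of_succ_le hk)
    have hM : AEMeasurable (fun p : (Fin k → ℝ) × ℝ =>
        marginal (f ∘ combo z) (k + 1) (snocEquiv k p)) (volume.prod volume) :=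
      (aemeasurable_marginal hF hk).comp_quasiMeasurePreserving
        (measurePreserving_snocEquiv k).quasiMeasurePreserving
    obtain ⟨h1, h2⟩ := map_idfStep (μ := cubeVol k) hC hM
      (fun p => marginal_nonneg (F := f ∘ combo z) (fun _ => hF0 _) _)
      (integral_marginal_succ hF hk) hm hmap
    have hcomp : fieldPrefix z f hk ∘ snocEquiv k
        = snocEquiv k ∘ fun p : (Fin k → ℝ) × ℝ => (fieldPrefix z f (Nat.le_of_succ_le hk) p.1,
          idf (stepDensity z f hk p.1) p.2) := by
      ext1 p
      exact fieldPrefix_snocEquiv z f hk p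
    have hU : AEMeasurable (fieldPrefix z f hk) (cubeVol (k + 1)) := by
      rw [← (measurePreserving_snocEquiv_cube k).aemeasurable_comp_iff
        (snocEquiv k).measurableEmbedding, hcomp]
      exact (snocEquiv k).measurable.comp_aemeasurable h1
    refine ⟨hU, ?_⟩
    have hmp := measurePreserving_snocEquiv_cube k
    have hU' := hU
    rw [← hmp.map_eq] at hU'
    rw [← hmp.map_eq, AEMeasurable.map_map_of_aemeasurable hU' hmp.measurable.aemeasurable, hcomp,
      ← map_withDensity_equiv (snocEquiv k) (measurePreserving_snocEquiv k)]
    refine Eq.trans ?_ (congrArg _ h2)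
    exact (AEMeasurable.map_map_of_aemeasurable (snocEquiv k).measurable.aemeasurable h1).symm

theorem map_fieldPrefix_absolutelyContinuous (hF0 : ∀ x, 0 ≤ f x) (hF : Integrable (f ∘ combo z))
    (hC : 0 < ∫ c, f (combo z c)) {k : ℕ} (hk : k ≤ n) :
    (cubeVol k).map (fieldPrefix z f hk) ≪ volume := by
  rw [(map_fieldPrefix hF0 hF hC hk).2]
  exact withDensity_absolutelyContinuous _ _

theorem aemeasurable_marginal_fieldPrefix (hF0 : ∀ x, 0 ≤ f x) (hF : Integrable (f ∘ combo z))
    (hC : 0 < ∫ c, f (combo z c)) {k : ℕ} (hk : k ≤ n) :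
    AEMeasurable (fun x => marginal (f ∘ combo z) k (fieldPrefix z f hk x)) (cubeVol k) :=
  ((aemeasurable_marginal hF hk).mono_ac
    (map_fieldPrefix_absolutelyContinuous hF0 hF hC hk)).comp_aemeasurable
    (map_fieldPrefix hF0 hF hC hk).1

theorem ae_marginal_fieldPrefix_pos (hF0 : ∀ x, 0 ≤ f x) (hF : Integrable (f ∘ combo z))
    (hC : 0 < ∫ c, f (combo z c)) {k : ℕ} (hk : k ≤ n) :
    ∀ᵐ x ∂(cubeVol k), 0 < marginal (f ∘ combo z) k (fieldPrefix z f hk x) := by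
  refine ae_of_ae_map (map_fieldPrefix hF0 hF hC hk).1
    (p := fun y => 0 < marginal (f ∘ combo z) k y) ?_
  rw [(map_fieldPrefix hF0 hF hC hk).2,
    ae_withDensity_iff' ((aemeasurable_marginal hF hk).div_const _).ennreal_ofReal]
  filter_upwards with y hy
  refine lt_of_le_of_ne (marginal_nonneg (F := f ∘ combo z) (fun _ => hF0 _) _) fun h => hy ?_
  rw [← h]
  simp

/-- Properties holding for almost every prefix of coordinates pull back along the field since its
law is absolutely continuous; that law also avoids the zeros of the marginal. -/
theorem ae_stepDensity (hF0 : ∀ x, 0 ≤ f x) (hF : Integrable (f ∘ combo z))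
    (hC : 0 < ∫ c, f (combo z c)) {k : ℕ} (hk : k < n) :
    ∀ᵐ x ∂(cubeVol k), Admissible (stepDensity z f hk x) ∧
      ∫ r, stepDensity z f hk x r = marginal (f ∘ combo z) k (fieldPrefix z f hk.le x) := by
  have h := ae_of_ae_map (map_fieldPrefix hF0 hF hC hk.le).1
    ((map_fieldPrefix_absolutelyContinuous hF0 hF hC hk.le).ae_le (integral_marginal_succ hF hk))
  filter_upwards [h, ae_marginal_fieldPrefix_pos hF0 hF hC hk.le] with x h1 h2
  exact ⟨⟨h1.1, h2.trans_eq h1.2.symm⟩, h1.2⟩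

/-! ### The potential as a chart -/

variable {lam : ℝ} {w : Fin n → (Fin n → ℝ) → ℝ}

/-- The Jacobian of the first `k` components of the potential. -/
def potDensity (z : Fin n → Fin n → ℝ) (f g : (Fin n → ℝ) → ℝ) (lam : ℝ) {k : ℕ} (hk : k ≤ n)
    (x : Fin k → ℝ) : ℝ :=
  ((∫ c, f (combo z c)) / marginal (f ∘ combo z) k (fieldPrefix z f hk x)) ^ (1 - lam) *
    ((∫ c, g (combo z c)) / marginal (g ∘ combo z) k (fieldPrefix z g hk x)) ^ lam

/-- The case `c = 0` is allowed, so telescoping needs positivity of the earlier marginal only. -/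
theorem div_rpow_mul_div_rpow {a b c : ℝ} (ha : 0 ≤ a) (hb : 0 < b) (hc : 0 ≤ c) (p : ℝ) :
    (a / b) ^ p * (b / c) ^ p = (a / c) ^ p := by
  rw [← Real.mul_rpow (by positivity) (by positivity), div_mul_div_cancel₀ hb.ne']

theorem aemeasurable_potDensity (hf0 : ∀ x, 0 ≤ f x) (hg0 : ∀ x, 0 ≤ g x) (hf : Integrable (f ∘ combo z))
    (hg : Integrable (g ∘ combo z)) (hfC : 0 < ∫ c, f (combo z c))
    (hgC : 0 < ∫ c, g (combo z c))
    {k : ℕ} (hk : k ≤ n) :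
    AEMeasurable (potDensity z f g lam hk) (cubeVol k) :=
  (((aemeasurable_marginal_fieldPrefix hf0 hf hfC hk).const_div _).pow_const _).mul
    (((aemeasurable_marginal_fieldPrefix hg0 hg hgC hk).const_div _).pow_const _)

theorem ae_mem_stepGood (hf0 : ∀ x, 0 ≤ f x) (hg0 : ∀ x, 0 ≤ g x) (hf : Integrable (f ∘ combo z))
    (hg : Integrable (g ∘ combo z)) (hfC : 0 < ∫ c, f (combo z c))
    (hgC : 0 < ∫ c, g (combo z c))
    (hw : IsGeomPotential z f g lam w) {k : ℕ} (hk : k < n) :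
    ∀ᵐ x ∂(cubeVol k), x ∈ stepGood z f g lam w hk := by
  filter_upwards [ae_stepDensity hf0 hf hfC hk, ae_stepDensity hg0 hg hgC hk,
    ae_isGeomPrimitive hw hk] with x h1 h2 h3 using ⟨h1.1, h2.1, h3⟩

/-- Induction by `IsChart.prod_shear`. The two claims go together: the next chart lives over
prefixes in the previous domain, which must have full measure. -/
theorem isChart_potPrefix (hf0 : ∀ x, 0 ≤ f x) (hg0 : ∀ x, 0 ≤ g x) (hf : Integrable (f ∘ combo z))
    (hg : Integrable (g ∘ combo z)) (hfC : 0 < ∫ c, f (combo z c))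
    (hgC : 0 < ∫ c, g (combo z c))
    (hlam : lam ∈ Icc (0 : ℝ) 1) (hw : IsGeomPotential z f g lam w) {k : ℕ}
    (hk : k ≤ n) :
    (∀ᵐ x ∂(cubeVol k), x ∈ prefixDomain z f g lam w hk) ∧
    IsChart (cubeVol k) volume (prefixDomain z f g lam w hk) (potPrefix w hk)
      fun x => ENNReal.ofReal (potDensity z f g lam hk x) := by
  induction k with
  | zero =>
    have h1 : prefixDomain z f g lam w hk = univ := by
      ext x
      simp [prefixDomain, cube]
    have h2 : potPrefix w hk = id := Subsingleton.elim _ _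
    have h4 : ∀ x, potDensity z f g lam hk x = 1 := fun x => by
      have e1 : (∫ c, (f ∘ combo z) c) = ∫ c, f (combo z c) := rfl
      have e2 : (∫ c, (g ∘ combo z) c) = ∫ c, g (combo z c) := rfl
      rw [potDensity, marginal_zero hf, marginal_zero hg, e1, e2, div_self hfC.ne',
        div_self hgC.ne', Real.one_rpow, Real.one_rpow, one_mul]
    refine ⟨by simp [h1], id, fun x _ => by simp [h2], by simp [h1, h2],
      by rw [h2]; exact aemeasurable_id, ?_⟩
    simp only [h1, h2, h4, cubeVol_zero, image_id, Measure.restrict_univ, Measure.map_id, ENNReal.ofReal_one]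
    exact withDensity_one.symm
  | succ k ih =>
    have hk' : k < n := hk
    obtain ⟨hD, hchart⟩ := ih hk'.le
    have hgood := ae_mem_stepGood hf0 hg0 hf hg hfC hgC hw hk'
    have hG : ∀ᵐ x ∂(cubeVol k),
        x ∈ prefixDomain z f g lam w hk'.le ∩ stepGood z f g lam w hk' := by
      filter_upwards [hD, hgood] with x h1 h2 using ⟨h1, h2⟩
    have hmp := measurePreserving_snocEquiv_cube k
    have hnf : ∀ x r, 0 ≤ stepDensity z f hk' x r := fun x r =>
      marginal_nonneg (F := f ∘ combo z) (fun _ => hf0 _) _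
    have hng : ∀ x r, 0 ≤ stepDensity z g hk' x r := fun x r =>
      marginal_nonneg (F := g ∘ combo z) (fun _ => hg0 _) _
    have hfst := Measure.quasiMeasurePreserving_fst (μ := cubeVol k) (ν := unitVol)
    -- The density of the new variable: the derivative of component `k` of each field is the ratio
    -- of its marginals of orders `k` and `k + 1`.
    have hk_aem : AEMeasurable (fun p : (Fin k → ℝ) × ℝ => ENNReal.ofReal
        ((marginal (f ∘ combo z) k (fieldPrefix z f hk'.le p.1) /
          marginal (f ∘ combo z) (k + 1) (fieldPrefix z f hk (snocEquiv k p))) ^ (1 - lam) *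
        (marginal (g ∘ combo z) k (fieldPrefix z g hk'.le p.1) /
          marginal (g ∘ combo z) (k + 1) (fieldPrefix z g hk (snocEquiv k p))) ^ lam))
        ((cubeVol k).prod unitVol) := by
      have a1 := (aemeasurable_marginal_fieldPrefix hf0 hf hfC hk'.le).comp_quasiMeasurePreserving
        hfst
      have a2 := (aemeasurable_marginal_fieldPrefix hg0 hg hgC hk'.le).comp_quasiMeasurePreserving
        hfst
      have a3 := (aemeasurable_marginal_fieldPrefix hf0 hf hfC hk).comp_quasiMeasurePreserving
        hmp.quasiMeasurePreserving
      have a4 := (aemeasurable_marginal_fieldPrefix hg0 hg hgC hk).comp_quasiMeasurePreserving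
        hmp.quasiMeasurePreserving
      exact (((a1.div a3).pow_const _).mul ((a2.div a4).pow_const _)).ennreal_ofReal
    have hstep := hchart.prod_shear
      (aemeasurable_potDensity hf0 hg0 hf hg hfC hgC hk'.le).ennreal_ofReal
      inter_subset_left hG (aemeasurable_stepPotential hw hk')
      (fun x hx => hx.2.2.2.strictMonoOn hlam hx.2.1 hx.2.2.1 (hnf x) (hng x))
      (fun x hx => hx.2.2.2.continuousOn hlam hx.2.1 hx.2.2.1 (hnf x) (hng x)) hk_aem (by
        filter_upwards [hgood, ae_stepDensity hf0 hf hfC hk', ae_stepDensity hg0 hg hgC hk'] with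
          x hx hxf hxg a ha b hb hab
        rw [← (hx.2.2.lintegral_Ioo hlam hx.1 hx.2.1 (hnf x) (hng x) ha hb hab).2]
        simp only [fieldPrefix_snocEquiv z f hk', fieldPrefix_snocEquiv z g hk', hxf.2, hxg.2]
        rfl)
    -- Telescoping: the marginal of order `k` cancels between the old Jacobian and the new factor.
    have hJ : (fun p : (Fin k → ℝ) × ℝ => ENNReal.ofReal (potDensity z f g lam hk'.le p.1) *
        ENNReal.ofReal
        ((marginal (f ∘ combo z) k (fieldPrefix z f hk'.le p.1) /
          marginal (f ∘ combo z) (k + 1) (fieldPrefix z f hk (snocEquiv k p))) ^ (1 - lam) *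
        (marginal (g ∘ combo z) k (fieldPrefix z g hk'.le p.1) /
          marginal (g ∘ combo z) (k + 1) (fieldPrefix z g hk (snocEquiv k p))) ^ lam))
        =ᵐ[(cubeVol k).prod unitVol]
        fun p => ENNReal.ofReal (potDensity z f g lam hk (snocEquiv k p)) := by
      filter_upwards [hfst.ae (ae_marginal_fieldPrefix_pos hf0 hf hfC hk'.le),
        hfst.ae (ae_marginal_fieldPrefix_pos hg0 hg hgC hk'.le)] with p h1 h2
      have n1 := marginal_nonneg (F := f ∘ combo z) (fun _ => hf0 _)
        (fieldPrefix z f hk (snocEquiv k p))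
      have n2 := marginal_nonneg (F := g ∘ combo z) (fun _ => hg0 _)
        (fieldPrefix z g hk (snocEquiv k p))
      rw [← ENNReal.ofReal_mul (by unfold potDensity; positivity), potDensity, potDensity,
        mul_mul_mul_comm, div_rpow_mul_div_rpow hfC.le h1 n1, div_rpow_mul_div_rpow hgC.le h2 n2]
    rw [show prefixDomain z f g lam w hk = _ from prefixDomain_succ hk']
    constructor
    · rw [← hmp.map_eq, (snocEquiv k).measurableEmbedding.ae_map_iff]
      filter_upwards [hfst.ae hG, Measure.quasiMeasurePreserving_snd.ae
        (ae_restrict_mem measurableSet_Ioo)] with p h1 h2 using ⟨p, ⟨h1, h2⟩, rfl⟩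
    · exact (hstep.congr_density hJ).transport (snocEquiv k) (snocEquiv k) hmp
        (measurePreserving_snocEquiv k) fun p hp =>
          potPrefix_snocEquiv hw hk' hp.1.1.1 hp.2

/-! ### The geometric combination in the coordinates given by `z` -/

theorem integral_geomComb_combo (hz : Function.Injective (combo z)) (hf0 : ∀ x, 0 ≤ f x)
    (hg0 : ∀ x, 0 ≤ g x) (hf : Integrable (f ∘ combo z)) (hg : Integrable (g ∘ combo z))
    (hfC : 0 < ∫ c, f (combo z c)) (hgC : 0 < ∫ c, g (combo z c))
    (hlam : lam ∈ Icc (0 : ℝ) 1) (hw : IsGeomPotential z f g lam w) :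
    Integrable (fun c => geomComb z f g lam w (combo z c)) ∧
    ∫ c, geomComb z f g lam w (combo z c)
      = (∫ c, f (combo z c)) ^ (1 - lam) * (∫ c, g (combo z c)) ^ lam := by
  obtain ⟨-, T, hT, hE, hTm, hmap⟩ := isChart_potPrefix hf0 hg0 hf hg hfC hgC hlam hw le_rfl
  set D := prefixDomain z f g lam w le_rfl with hD
  have hpot : ∀ t, potPrefix w le_rfl t = fun i => w i t := fun t => by
    ext i
    simp only [potPrefix, extend_self]
    rfl
  set Φ : (Fin n → ℝ) → ℝ := fun t => marginal (f ∘ combo z) n (fieldPrefix z f le_rfl t) ^ (1 - lam)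
    * marginal (g ∘ combo z) n (fieldPrefix z g le_rfl t) ^ lam with hΦ
  have hΦ' : ∀ t, f (idField z f t) ^ (1 - lam) * g (idField z g t) ^ lam = Φ t := fun t => by
    simp only [hΦ, marginal_self, fieldPrefix, extend_self, initial_self, idField,
      Function.comp_apply]
  have hΦ0 : ∀ t, 0 ≤ Φ t := fun t => by
    rw [← hΦ']
    have h1 := hf0 (idField z f t)
    have h2 := hg0 (idField z g t)
    positivity
  have hΦm : AEMeasurable Φ (cubeVol n) :=
    ((aemeasurable_marginal_fieldPrefix hf0 hf hfC le_rfl).pow_const _).mul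
      ((aemeasurable_marginal_fieldPrefix hg0 hg hgC le_rfl).pow_const _)
  have hgc : (fun c => geomComb z f g lam w (combo z c))
      = (potPrefix w le_rfl '' D).indicator (Φ ∘ T) := by
    classical
    ext c
    have hiff : (∃ t ∈ domain z f g lam w, combo z (fun i => w i t) = combo z c) ↔
        c ∈ potPrefix w le_rfl '' D := by
      rw [domain_eq hw]
      refine exists_congr fun t => and_congr_right fun _ => ?_
      rw [hz.eq_iff, hpot]
    rw [geomComb, indicator_apply]
    by_cases h : ∃ t ∈ domain z f g lam w, combo z (fun i => w i t) = combo z c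
    · rw [dif_pos h, if_pos (hiff.1 h), hΦ', Function.comp_apply]
      congr 1
      -- The chosen preimage is `T c`, since `combo z` is injective and `T` inverts the potential on
      -- `D`.
      obtain ⟨h1, h2⟩ := h.choose_spec
      have h3 : h.choose ∈ D := by
        rw [hD, ← domain_eq hw]
        exact h1
      have h4 := hT _ h3
      rw [hpot, hz h2] at h4
      exact h4.symm
    · rw [dif_neg h, if_neg fun h' => h (hiff.2 h')]
  have hΦTm' : AEMeasurable Φ ((volume.restrict (potPrefix w le_rfl '' D)).map T) := by
    rw [hmap]
    exact hΦm.mono_ac (withDensity_absolutelyContinuous _ _)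
  have haem : AEMeasurable (fun c => geomComb z f g lam w (combo z c)) volume := by
    rw [hgc, aemeasurable_indicator_iff₀ hE]
    exact hΦTm'.comp_aemeasurable hTm
  have hnn : ∀ c, 0 ≤ geomComb z f g lam w (combo z c) := fun c => by
    rw [congrFun hgc c]
    exact indicator_nonneg (fun _ _ => hΦ0 _) _
  have hlint : ∫⁻ c, ENNReal.ofReal (geomComb z f g lam w (combo z c))
      = ENNReal.ofReal ((∫ c, f (combo z c)) ^ (1 - lam) * (∫ c, g (combo z c)) ^ lam) := by
    have h1 : (fun c => ENNReal.ofReal (geomComb z f g lam w (combo z c)))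
        = (potPrefix w le_rfl '' D).indicator fun c => ENNReal.ofReal (Φ (T c)) := by
      ext c
      rw [congrFun hgc c]
      by_cases hc : c ∈ potPrefix w le_rfl '' D <;> simp [hc]
    rw [h1, lintegral_indicator₀ hE, ← lintegral_map' (f := fun t => ENNReal.ofReal (Φ t))
      hΦTm'.ennreal_ofReal hTm, hmap, lintegral_withDensity_eq_lintegral_mul₀
      (aemeasurable_potDensity hf0 hg0 hf hg hfC hgC le_rfl).ennreal_ofReal hΦm.ennreal_ofReal]
    -- The Jacobian cancels the value of the combination wherever both densities are positive; the
    -- constant left is integrated against a probability measure.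
    have h2 : ∀ᵐ t ∂(cubeVol n), ENNReal.ofReal (potDensity z f g lam le_rfl t) *
        ENNReal.ofReal (Φ t)
        = ENNReal.ofReal ((∫ c, f (combo z c)) ^ (1 - lam) * (∫ c, g (combo z c)) ^ lam) := by
      filter_upwards [ae_marginal_fieldPrefix_pos hf0 hf hfC le_rfl,
        ae_marginal_fieldPrefix_pos hg0 hg hgC le_rfl] with t h1 h2
      rw [← ENNReal.ofReal_mul (by unfold potDensity; positivity), hΦ, potDensity,
        mul_mul_mul_comm, ← Real.mul_rpow (by positivity) h1.le,
        ← Real.mul_rpow (by positivity) h2.le, div_mul_cancel₀ _ h1.ne', div_mul_cancel₀ _ h2.ne']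
    exact (lintegral_congr_ae h2).trans (by simp)
  constructor
  · refine ⟨haem.aestronglyMeasurable, ?_⟩
    rw [hasFiniteIntegral_iff_ofReal (Eventually.of_forall hnn), hlint]
    exact ofReal_lt_top
  · rw [integral_eq_lintegral_of_nonneg_ae (Eventually.of_forall hnn) haem.aestronglyMeasurable,
      hlint, ENNReal.toReal_ofReal (by positivity)]

/-! ### Linear change of variables -/

/-- Only positivity of `a` is recorded, as its value cancels in the end. -/
theorem exists_map_combo (hz : LinearIndependent ℝ z) :
    MeasurableEmbedding (combo z) ∧ ∃ a : ℝ, 0 < a ∧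
      (volume : Measure (Fin n → ℝ)).map (combo z) = ENNReal.ofReal a • volume := by
  set L : (Fin n → ℝ) →ₗ[ℝ] (Fin n → ℝ) := Fintype.linearCombination ℝ z with hL
  have hcoe : combo z = L := by
    ext1 c
    rw [hL, Fintype.linearCombination_apply]
    rfl
  have hker : LinearMap.ker L = ⊥ :=
    LinearMap.ker_eq_bot.2 (linearIndependent_iff_injective_fintypeLinearCombination.1 hz)
  have hdet : LinearMap.det L ≠ 0 := fun h =>
    (LinearMap.bot_lt_ker_of_det_eq_zero h).ne' hker
  refine ⟨?_, |(LinearMap.det L)⁻¹|, by positivity, ?_⟩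
  · rw [hcoe]
    exact (LinearMap.isClosedEmbedding_of_injective hker).measurableEmbedding
  · rw [hcoe]
    exact Measure.map_linearMap_addHaar_eq_smul_addHaar volume hdet

end

end GeomComb

theorem theorem2p10 (n : ℕ) (z : Fin n → Fin n → ℝ) (hz : LinearIndependent ℝ z)
    (f g : (Fin n → ℝ) → ℝ)
    (hf_nonneg : ∀ x, 0 ≤ f x) (hg_nonneg : ∀ x, 0 ≤ g x)
    (hf_int : MeasureTheory.Integrable f MeasureTheory.volume)
    (hg_int : MeasureTheory.Integrable g MeasureTheory.volume)
    (hf_pos : 0 < ∫ x, f x) (hg_pos : 0 < ∫ x, g x)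
    (lam : ℝ) (hlam : lam ∈ Set.Icc (0 : ℝ) 1)
    (w : Fin n → (Fin n → ℝ) → ℝ) (hw : GeomComb.IsGeomPotential z f g lam w) :
    MeasureTheory.NullMeasurable (GeomComb.geomComb z f g lam w) MeasureTheory.volume ∧
    MeasureTheory.Integrable (GeomComb.geomComb z f g lam w) MeasureTheory.volume ∧
    ∫ x, GeomComb.geomComb z f g lam w x = (∫ x, f x) ^ (1 - lam) * (∫ x, g x) ^ lam := by
  obtain ⟨hemb, a, ha, hmap⟩ := GeomComb.exists_map_combo hz
  have hint : ∀ h : (Fin n → ℝ) → ℝ, Integrable (h ∘ GeomComb.combo z) ↔ Integrable h := fun h => by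
    rw [← hemb.integrable_map_iff, hmap, integrable_smul_measure (by simpa using ha)
      ENNReal.ofReal_ne_top]
  have hval : ∀ h : (Fin n → ℝ) → ℝ, ∫ c, h (GeomComb.combo z c) = a * ∫ x, h x := fun h => by
    rw [← hemb.integral_map, hmap, integral_smul_measure, ENNReal.toReal_ofReal ha.le, smul_eq_mul]
  obtain ⟨h1, h2⟩ := GeomComb.integral_geomComb_combo hemb.injective hf_nonneg hg_nonneg
    ((hint f).2 hf_int) ((hint g).2 hg_int) (by rw [hval]; positivity) (by rw [hval]; positivity)
    hlam hw
  have h3 := (hint (GeomComb.geomComb z f g lam w)).1 h1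
  refine ⟨h3.aestronglyMeasurable.aemeasurable.nullMeasurable, h3, ?_⟩
  -- The right side acquires a^(1-λ) a^λ = a, the same factor as the left side.
  rw [hval, hval, hval, Real.mul_rpow ha.le hf_pos.le, Real.mul_rpow ha.le hg_pos.le,
    mul_mul_mul_comm, ← Real.rpow_add ha, sub_add_cancel, Real.rpow_one] at h2
  exact mul_left_cancel₀ ha.ne' h2
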